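/- Let $\mathbb{k}$ be $\mathbb{R}$ or $\mathbb{C}$. Let $\mathsf{OSys}$ be the category of (not necessarily complete) operator systems over $\mathbb{k}$, i.e. matrix-ordered $*$-vector spaces with an Archimedean matrix order unit, with unital completely positive maps as morphisms, where $\|s\|\le r$ means $\begin{pmatrix} re & s\\ s^* & re\end{pmatrix}\ge 0$. Let $\mathsf{OSys}^{\wedge}\subset\mathsf{OSys}$ be the full subcategory of complete operator systems, and $\mathsf{OSys}^{\wedge}_c\subset\mathsf{OSys}^{\wedge}$ the full subcategory of complete function systems, i.e. complete operator systems that admit a unital complete order embedding into $C(X)$ for some compact Hausdorff space $X$. Let $\mathsf{OSys}^{\wedge}_s$ (respectively $\mathsf{OSys}^{\wedge}_{bs}$) be the full subcategory of those $S\in\mathsf{OSys}^{\wedge}_c$ whose dual compact convex set, the space of positive unital functionals on $S$ with the topology of pointwise convergence, is a Choquet simplex (respectively a Bauer simplex, i.e. a Choquet simplex whose set of extreme points is closed). For a compact convex subset $K$ of a Hausdorff locally convex space, write $A(K)$ for the operator system of continuous affine functions $K\to\mathbb{k}$ with the pointwise matrix order. Morphisms of compact convex sets are continuous affine maps. Let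 $\Delta^n$ be the standard $n$-dimensional simplex, and let $f,g:\Delta^0\to\Delta^3$ send the point to the midpoints of two opposite edges of the tetrahedron. Then: 1. The coequalizer of $f,g$ in the category of compact convex sets is the square $[0,1]^2$. There is no universal arrow from $[0,1]^2$ to the inclusion of the full subcategory of Choquet simplices, nor to that of Bauer simplices. The pair $f,g$ has no coequalizer in the category of Choquet simplices, nor in that of Bauer simplices. 2. $A(\Delta^3)$ and $A(\Delta^0)$ belong to $\mathsf{OSys}^{\wedge}_{bs}\subset\mathsf{OSys}^{\wedge}_s$, and the dual pair $A(f),A(g):A(\Delta^3)\to A(\Delta^0)$ has no equalizer in $\mathsf{OSys}^{\wedge}_s$ and none in $\mathsf{OSys}^{\wedge}_{bs}$. In particular, the categories $\mathsf{OSys}^{\wedge}_{s}$ and $\mathsf{OSys}^{\wedge}_{bs}$ do not have equalizers. 3. The categories $\mathsf{OSys}^{\wedge}_{s}$ and $\mathsf{OSys}^{\wedge}_{bs}$ are not locally presentable, i.e. not locally $\kappa$-presentable for any regular cardinal $\kappa$. 4. None of the full inclusions of $\mathsf{OSys}^{\wedge}_{s}$ or $\mathsf{OSys}^{\wedge}_{bs}$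 into $\mathsf{OSys}^{\wedge}_c$, $\mathsf{OSys}^{\wedge}$ or $\mathsf{OSys}$ is reflective. -/

import Mathlib

open CategoryTheory Limits
open scoped ComplexOrder

universe u

/-! ### Operator systems over `𝕜 = ℝ` or `ℂ` -/

/-- The compression `αᴴ x α` of a matrix `x` over a vector space by a scalar matrix `α`. -/
def compress {𝕜 S : Type*} [RCLike 𝕜] [AddCommGroup S] [Module 𝕜 S] {n m : ℕ}
    (α : Matrix (Fin n) (Fin m) 𝕜) (x : Matrix (Fin n) (Fin n) S) : Matrix (Fin m) (Fin m) S :=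
  fun i j => ∑ k, ∑ l, (star (α k i) * α l j) • x k l

/-- A (not necessarily complete) operator system over `𝕜`: a matrix-ordered `*`-vector space with
an Archimedean matrix order unit. (Closure of the cones under scaling by `r ≥ 0` is the instance
`α = √r • 1` of `compress_mem`.) -/
structure OSys (𝕜 : Type) [RCLike 𝕜] : Type (u + 1) where
  carrier : Type u
  [addCommGroup : AddCommGroup carrier]
  [module : Module 𝕜 carrier]
  [starAddMonoid : StarAddMonoid carrier]
  [starModule : StarModule 𝕜 carrier]
  /-- the positive cone of the `n × n` matrices -/
  cone : ∀ n : ℕ, Set (Matrix (Fin n) (Fin n) carrier)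
  /-- the order unit -/
  unit : carrier
  isHermitian_of_mem : ∀ {n : ℕ} {x}, x ∈ cone n → x.IsHermitian
  zero_mem : ∀ n : ℕ, 0 ∈ cone n
  add_mem : ∀ {n : ℕ} {x y}, x ∈ cone n → y ∈ cone n → x + y ∈ cone n
  compress_mem : ∀ {n m : ℕ} {x} (α : Matrix (Fin n) (Fin m) 𝕜),
    x ∈ cone n → compress α x ∈ cone m
  proper : ∀ {n : ℕ} {x}, x ∈ cone n → -x ∈ cone n → x = 0
  orderUnit : ∀ {n : ℕ} (x : Matrix (Fin n) (Fin n) carrier), x.IsHermitian →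
    ∃ r : ℝ, 0 < r ∧ (Matrix.diagonal fun _ => (r : 𝕜) • unit) + x ∈ cone n
  archimedean : ∀ {n : ℕ} (x : Matrix (Fin n) (Fin n) carrier),
    (∀ r : ℝ, 0 < r → (Matrix.diagonal fun _ => (r : 𝕜) • unit) + x ∈ cone n) → x ∈ cone n

namespace OSys

attribute [instance] addCommGroup module starAddMonoid starModule

variable {𝕜 : Type} [RCLike 𝕜]

/-- Unital completely positive maps. -/
@[ext]
structure Hom (S T : OSys.{u} 𝕜) : Type u where
  toLinearMap : S.carrier →ₗ[𝕜] T.carrier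
  map_unit : toLinearMap S.unit = T.unit
  map_cone : ∀ (n : ℕ) (x : Matrix (Fin n) (Fin n) S.carrier),
    x ∈ S.cone n → x.map toLinearMap ∈ T.cone n

/-- The category of operator systems and unital completely positive maps. -/
instance : Category.{u} (OSys.{u} 𝕜) where
  Hom := Hom
  id S := ⟨LinearMap.id, rfl, fun _ _ hx => hx⟩
  comp f g := ⟨g.toLinearMap ∘ₗ f.toLinearMap,
    by rw [LinearMap.comp_apply, f.map_unit, g.map_unit],
    fun n x hx => g.map_cone n _ (f.map_cone n x hx)⟩

/-- `‖s‖ ≤ r` for the operator space norm of an operator system (`r > 0`). -/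
def NormLE (S : OSys.{u} 𝕜) (s : S.carrier) (r : ℝ) : Prop :=
  !![(r : 𝕜) • S.unit, s; star s, (r : 𝕜) • S.unit] ∈ S.cone 2

/-- Completeness: every sequence that is Cauchy for the norm converges. -/
def IsComplete : ObjectProperty (OSys.{u} 𝕜) := fun S =>
  ∀ s : ℕ → S.carrier,
    (∀ ε : ℝ, 0 < ε → ∃ N, ∀ m ≥ N, ∀ n ≥ N, S.NormLE (s m - s n) ε) →
    ∃ a : S.carrier, ∀ ε : ℝ, 0 < ε → ∃ N, ∀ n ≥ N, S.NormLE (s n - a) ε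

/-- There are a compact Hausdorff space `X` and a unital complete order embedding into `C(X)`;
a matrix over `C(X)` is positive when it is pointwise positive semidefinite. -/
def IsCommutative : ObjectProperty (OSys.{u} 𝕜) := fun S =>
  ∃ (X : Type u) (_ : TopologicalSpace X) (_ : CompactSpace X) (_ : T2Space X)
    (φ : S.carrier →ₗ[𝕜] C(X, 𝕜)), Function.Injective φ ∧ φ S.unit = 1 ∧
      ∀ (n : ℕ) (x : Matrix (Fin n) (Fin n) S.carrier),
        x ∈ S.cone n ↔ ∀ p : X, (x.map fun s => φ s p).PosSemidef

/-- Complete function systems: complete operator systems that embed into some `C(X)`. -/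
def IsFunctionSystem : ObjectProperty (OSys.{u} 𝕜) := fun S => S.IsComplete ∧ S.IsCommutative

/-- The state space, i.e. the set of positive unital linear functionals, as a subset of the space
of all functions `S → 𝕜` with the topology of pointwise convergence. -/
def stateSpace (S : OSys.{u} 𝕜) : Set (S.carrier → 𝕜) :=
  {f | ∃ φ : S.carrier →ₗ[𝕜] 𝕜, ⇑φ = f ∧ φ S.unit = 1 ∧
    ∀ s : S.carrier, !![s] ∈ S.cone 1 → 0 ≤ φ s}

end OSys

/-! ### Simplices -/

section Simplices

variable {E : Type*} [AddCommGroup E] [Module ℝ E] [TopologicalSpace E]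

/-- The cone over `K`, with `K` placed in the hyperplane `E × {1}` of `E × ℝ`. -/
def coneOver (K : Set E) : Set (E × ℝ) := {p | ∃ t : ℝ, 0 ≤ t ∧ ∃ x ∈ K, p = (t • x, t)}

/-- A (Choquet) simplex: a compact convex set `K` such that the space `P - P` spanned by the cone
`P` over `K` is a lattice in the order with positive cone `P`. -/
def IsChoquetSimplex (K : Set E) : Prop :=
  IsCompact K ∧ Convex ℝ K ∧
    ∀ a b : E × ℝ, (∃ p ∈ coneOver K, ∃ q ∈ coneOver K, a = p - q) →
      (∃ p ∈ coneOver K, ∃ q ∈ coneOver K, b = p - q) →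
      ∃ c : E × ℝ, c - a ∈ coneOver K ∧ c - b ∈ coneOver K ∧
        ∀ d : E × ℝ, d - a ∈ coneOver K → d - b ∈ coneOver K → d - c ∈ coneOver K

/-- A Bauer simplex: a simplex whose set of extreme points is closed. -/
def IsBauerSimplex (K : Set E) : Prop :=
  IsChoquetSimplex K ∧ IsClosed (K.extremePoints ℝ)

end Simplices

/-! ### Compact convex sets -/

/-- A compact convex subset of a Hausdorff locally convex real topological vector space. -/
structure CompConv : Type (u + 1) where
  V : Type u
  [addCommGroup : AddCommGroup V]
  [module : Module ℝ V]
  [topologicalSpace : TopologicalSpace V]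
  [isTopologicalAddGroup : IsTopologicalAddGroup V]
  [continuousSMul : ContinuousSMul ℝ V]
  [t2Space : T2Space V]
  [locallyConvexSpace : LocallyConvexSpace ℝ V]
  carrier : Set V
  isCompact : IsCompact carrier
  convex : Convex ℝ carrier

namespace CompConv

attribute [instance] addCommGroup module topologicalSpace isTopologicalAddGroup continuousSMul
  t2Space locallyConvexSpace

instance (K : CompConv.{u}) : CompactSpace K.carrier := isCompact_iff_compactSpace.mp K.isCompact

/-- Affine maps from a compact convex set to a real vector space. -/
def IsAffine (K : CompConv.{u}) {F : Type*} [AddCommGroup F] [Module ℝ F]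
    (f : K.carrier → F) : Prop :=
  ∀ (x y z : K.carrier) (a b : ℝ), 0 ≤ a → 0 ≤ b → a + b = 1 →
    (z : K.V) = a • (x : K.V) + b • (y : K.V) → f z = a • f x + b • f y

/-- Continuous affine maps. -/
@[ext]
structure Hom (K L : CompConv.{u}) : Type u where
  toMap : C(K.carrier, L.carrier)
  isAffine : K.IsAffine fun x => (toMap x : L.V)

/-- The category of compact convex sets and continuous affine maps. -/
instance : Category.{u} CompConv.{u} where
  Hom := Hom
  id K := ⟨ContinuousMap.id _, fun _ _ _ _ _ _ _ _ h => h⟩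
  comp f g := ⟨g.toMap.comp f.toMap, fun x y z a b ha hb hab h =>
    g.isAffine _ _ _ a b ha hb hab (f.isAffine x y z a b ha hb hab h)⟩

/-- The constant map with value `p`. -/
def const (K : CompConv.{u}) {L : CompConv.{u}} (p : L.carrier) : K ⟶ L where
  toMap := ContinuousMap.const _ p
  isAffine := fun x y z a b _ _ hab _ => by
    simp only [ContinuousMap.const_apply]
    rw [← add_smul, hab, one_smul]

/-- The property of being a Choquet simplex. -/
def IsChoquet : ObjectProperty CompConv.{u} := fun K => IsChoquetSimplex K.carrier

/-- The property of being a Bauer simplex. -/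
def IsBauer : ObjectProperty CompConv.{u} := fun K => IsBauerSimplex K.carrier

/-- The standard `n`-dimensional simplex `Δⁿ`. -/
def simplex (n : ℕ) : CompConv.{u} where
  V := ULift.{u} (Fin (n + 1)) → ℝ
  carrier := stdSimplex ℝ (ULift.{u} (Fin (n + 1)))
  isCompact := isCompact_stdSimplex ℝ _
  convex := convex_stdSimplex ℝ _

/-- The square `I²`, `I = [0, 1]`. -/
def square : CompConv.{u} where
  V := ULift.{u} (Fin 2) → ℝ
  carrier := Set.Icc 0 1
  isCompact := isCompact_Icc
  convex := convex_Icc 0 1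

/-- The midpoint of the edge of the tetrahedron `Δ³` that joins the vertices `i` and `j`. -/
noncomputable def edgeMidpoint (i j : Fin 4) : (simplex.{u} 3).carrier :=
  ⟨midpoint ℝ (Pi.single (ULift.up i) 1) (Pi.single (ULift.up j) 1),
    (convex_stdSimplex ℝ _).midpoint_mem (single_mem_stdSimplex ℝ _) (single_mem_stdSimplex ℝ _)⟩

/-- The map `Δ⁰ ⟶ Δ³` to the midpoint of the edge `{0, 1}`. -/
noncomputable def midF : simplex.{u} 0 ⟶ simplex.{u} 3 := const _ (edgeMidpoint 0 1)

/-- The map `Δ⁰ ⟶ Δ³` to the midpoint of the opposite edge `{2, 3}`. -/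
noncomputable def midG : simplex.{u} 0 ⟶ simplex.{u} 3 := const _ (edgeMidpoint 2 3)

end CompConv

namespace OSys

variable {𝕜 : Type} [RCLike 𝕜]

/-- The function systems whose dual compact convex set is a Choquet simplex. -/
def IsSimplexSystem : ObjectProperty (OSys.{u} 𝕜) := fun S =>
  S.IsFunctionSystem ∧ IsChoquetSimplex S.stateSpace

/-- The function systems whose dual compact convex set is a Bauer simplex. -/
def IsBauerSystem : ObjectProperty (OSys.{u} 𝕜) := fun S =>
  S.IsFunctionSystem ∧ IsBauerSimplex S.stateSpace

theorem isSimplexSystem_le : (IsSimplexSystem : ObjectProperty (OSys.{u} 𝕜)) ≤ IsFunctionSystem :=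
  fun _ h => h.1

theorem isBauerSystem_le : (IsBauerSystem : ObjectProperty (OSys.{u} 𝕜)) ≤ IsFunctionSystem :=
  fun _ h => h.1

theorem isFunctionSystem_le : (IsFunctionSystem : ObjectProperty (OSys.{u} 𝕜)) ≤ IsComplete :=
  fun _ h => h.1

end OSys

/-! ### The operator system `A(K)` of continuous affine functions -/

namespace CompConv

variable (𝕜 : Type) [RCLike 𝕜]

/-- The space of continuous affine `𝕜`-valued functions on `K`. -/
def affineFunctions (K : CompConv.{u}) : Submodule 𝕜 C(K.carrier, 𝕜) where
  carrier := {f | K.IsAffine f}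
  zero_mem' := fun _ _ _ _ _ _ _ _ _ => by simp
  add_mem' := fun {f g} hf hg x y z a b ha hb hab h => by
    simp only [ContinuousMap.add_apply, hf x y z a b ha hb hab h, hg x y z a b ha hb hab h,
      smul_add]
    abel
  smul_mem' := fun c f hf x y z a b ha hb hab h => by
    simp only [ContinuousMap.smul_apply, hf x y z a b ha hb hab h, smul_add, smul_comm c]

instance (K : CompConv.{u}) : Star (K.affineFunctions 𝕜) :=
  ⟨fun f => ⟨star f.1, fun x y z a b ha hb hab h => by
    simp only [ContinuousMap.star_apply, f.2 x y z a b ha hb hab h, star_add, star_smul,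
      star_trivial]⟩⟩

instance (K : CompConv.{u}) : StarAddMonoid (K.affineFunctions 𝕜) where
  star_involutive f := Subtype.ext (star_star f.1)
  star_add f g := Subtype.ext (star_add f.1 g.1)

instance (K : CompConv.{u}) : StarModule 𝕜 (K.affineFunctions 𝕜) where
  star_smul c f := Subtype.ext (star_smul c f.1)

variable {𝕜}

/-- The value of a matrix of functions at a point. -/
def evalAt {K : CompConv.{u}} {n : ℕ} (x : Matrix (Fin n) (Fin n) (K.affineFunctions 𝕜))
    (p : K.carrier) : Matrix (Fin n) (Fin n) 𝕜 := x.map fun f => f.1 p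

theorem evalAt_compress {K : CompConv.{u}} {n m : ℕ} (α : Matrix (Fin n) (Fin m) 𝕜)
    (x : Matrix (Fin n) (Fin n) (K.affineFunctions 𝕜)) (p : K.carrier) :
    evalAt (compress α x) p = α.conjTranspose * evalAt x p * α := by
  ext i j
  simp only [evalAt, compress, Matrix.map_apply, Matrix.mul_apply, Matrix.conjTranspose_apply,
    Submodule.coe_sum, ContinuousMap.sum_apply, Submodule.coe_smul, ContinuousMap.smul_apply,
    smul_eq_mul, Finset.sum_mul]
  rw [Finset.sum_comm]
  exact Finset.sum_congr rfl fun _ _ => Finset.sum_congr rfl fun _ _ => by ring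

theorem isHermitian_iff_evalAt {K : CompConv.{u}} {n : ℕ}
    {x : Matrix (Fin n) (Fin n) (K.affineFunctions 𝕜)} :
    x.IsHermitian ↔ ∀ p, (evalAt x p).IsHermitian := by
  constructor
  · intro h p
    ext i j
    exact congrArg (fun f : K.affineFunctions 𝕜 => f.1 p) (congrFun (congrFun h i) j)
  · intro h
    ext i j p
    exact congrFun (congrFun (h p) i) j

/-- The constant function `1`. -/
def affineOne (K : CompConv.{u}) : K.affineFunctions 𝕜 :=
  ⟨1, fun x y z a b _ _ hab _ => by
    simp only [ContinuousMap.one_apply]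
    rw [← add_smul, hab, one_smul]⟩

theorem evalAt_diagonal_add {K : CompConv.{u}} {n : ℕ}
    (x : Matrix (Fin n) (Fin n) (K.affineFunctions 𝕜)) (r : ℝ) (p : K.carrier) :
    evalAt ((Matrix.diagonal fun _ => (r : 𝕜) • (affineOne K : K.affineFunctions 𝕜)) + x) p =
      (r : 𝕜) • (1 : Matrix (Fin n) (Fin n) 𝕜) + evalAt x p := by
  ext i j
  by_cases h : i = j
  · subst h; simp [evalAt, affineOne]
  · simp [evalAt, h]

theorem quad_re {n : ℕ} (M : Matrix (Fin n) (Fin n) 𝕜) (r : ℝ) (ξ : Fin n → 𝕜) :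
    RCLike.re (dotProduct (star ξ) (((r : 𝕜) • (1 : Matrix (Fin n) (Fin n) 𝕜) + M).mulVec ξ)) =
      r * ∑ i, ‖ξ i‖ ^ 2 + RCLike.re (dotProduct (star ξ) (M.mulVec ξ)) := by
  rw [Matrix.add_mulVec, dotProduct_add, map_add, Matrix.smul_mulVec, Matrix.one_mulVec,
    dotProduct_smul, smul_eq_mul, RCLike.re_ofReal_mul]
  congr 2
  simp only [dotProduct, Pi.star_apply, map_sum]
  refine Finset.sum_congr rfl fun i _ => ?_
  rw [RCLike.star_def, RCLike.conj_mul, ← RCLike.ofReal_pow, RCLike.ofReal_re]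

theorem posSemidef_of_re {n : ℕ} {M : Matrix (Fin n) (Fin n) 𝕜} (h : M.IsHermitian)
    (h' : ∀ ξ : Fin n → 𝕜, 0 ≤ RCLike.re (dotProduct (star ξ) (M.mulVec ξ))) : M.PosSemidef :=
  .of_dotProduct_mulVec_nonneg h fun ξ =>
    RCLike.nonneg_iff.mpr ⟨h' ξ, h.im_star_dotProduct_mulVec_self ξ⟩

theorem isHermitian_real_smul_one {n : ℕ} (r : ℝ) :
    ((r : 𝕜) • (1 : Matrix (Fin n) (Fin n) 𝕜)).IsHermitian := by
  rw [Matrix.IsHermitian, Matrix.conjTranspose_smul, Matrix.conjTranspose_one, RCLike.star_def,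
    RCLike.conj_ofReal]

theorem quad_bound {n : ℕ} (M : Matrix (Fin n) (Fin n) 𝕜) {C : ℝ} (hC : ∀ i j, ‖M i j‖ ≤ C)
    (ξ : Fin n → 𝕜) :
    -((n * n * C) * ∑ i, ‖ξ i‖ ^ 2) ≤ RCLike.re (dotProduct (star ξ) (M.mulVec ξ)) := by
  set q := ∑ i, ‖ξ i‖ ^ 2 with hq
  have hs : ∀ i, ‖ξ i‖ ^ 2 ≤ q := fun i =>
    Finset.single_le_sum (f := fun i => ‖ξ i‖ ^ 2) (fun _ _ => sq_nonneg _) (Finset.mem_univ i)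
  have hterm : ∀ i j, ‖star (ξ i) * (M i j * ξ j)‖ ≤ C * q := fun i j => by
    have h0 : 0 ≤ C := (norm_nonneg _).trans (hC i j)
    have h1 : ‖ξ i‖ * ‖ξ j‖ ≤ q := by nlinarith [hs i, hs j, sq_nonneg (‖ξ i‖ - ‖ξ j‖)]
    calc ‖star (ξ i) * (M i j * ξ j)‖ = ‖M i j‖ * (‖ξ i‖ * ‖ξ j‖) := by
          rw [norm_mul, norm_mul, norm_star]; ring
      _ ≤ C * q := mul_le_mul (hC i j) h1 (by positivity) h0
  have hn : ‖dotProduct (star ξ) (M.mulVec ξ)‖ ≤ n * n * C * q := by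
    simp only [dotProduct, Matrix.mulVec, Pi.star_apply, Finset.mul_sum]
    calc _ ≤ ∑ i : Fin n, ∑ j : Fin n, C * q :=
          (norm_sum_le _ _).trans (Finset.sum_le_sum fun i _ =>
            (norm_sum_le _ _).trans (Finset.sum_le_sum fun j _ => hterm i j))
      _ = n * n * C * q := by simp; ring
  have := (abs_le.mp ((RCLike.abs_re_le_norm _).trans hn)).1
  linarith

theorem affine_orderUnit {K : CompConv.{u}} {n : ℕ}
    (x : Matrix (Fin n) (Fin n) (K.affineFunctions 𝕜)) (hx : x.IsHermitian) :
    ∃ r : ℝ, 0 < r ∧ ∀ p, (evalAt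
      ((Matrix.diagonal fun _ => (r : 𝕜) • (affineOne K : K.affineFunctions 𝕜)) + x) p).PosSemidef := by
  set C : ℝ := ∑ i, ∑ j, ‖(x i j).1‖ with hCdef
  have hC : ∀ i j, ‖(x i j).1‖ ≤ C := fun i j =>
    (Finset.single_le_sum (f := fun j => ‖(x i j).1‖) (fun _ _ => norm_nonneg _)
      (Finset.mem_univ j)).trans
    (Finset.single_le_sum (f := fun i => ∑ j, ‖(x i j).1‖)
      (fun _ _ => Finset.sum_nonneg fun _ _ => norm_nonneg _) (Finset.mem_univ i))
  have hC0 : 0 ≤ C := Finset.sum_nonneg fun _ _ => Finset.sum_nonneg fun _ _ => norm_nonneg _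
  refine ⟨n * n * C + 1, by positivity, fun p => ?_⟩
  rw [evalAt_diagonal_add]
  refine posSemidef_of_re ((isHermitian_real_smul_one _).add (isHermitian_iff_evalAt.mp hx p))
    fun ξ => ?_
  rw [quad_re]
  have h1 := quad_bound (evalAt x p)
    (fun i j => ((x i j).1.norm_coe_le_norm p).trans (hC i j)) ξ
  have h2 : 0 ≤ ∑ i, ‖ξ i‖ ^ 2 := Finset.sum_nonneg fun _ _ => sq_nonneg _
  linarith

theorem affine_archimedean {K : CompConv.{u}} {n : ℕ}
    (x : Matrix (Fin n) (Fin n) (K.affineFunctions 𝕜))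
    (hx : ∀ r : ℝ, 0 < r → ∀ p, (evalAt
      ((Matrix.diagonal fun _ => (r : 𝕜) • (affineOne K : K.affineFunctions 𝕜)) + x) p).PosSemidef)
    (p : K.carrier) : (evalAt x p).PosSemidef := by
  have hr : ∀ r : ℝ, 0 < r → ((r : 𝕜) • (1 : Matrix (Fin n) (Fin n) 𝕜) + evalAt x p).PosSemidef :=
    fun r h => by rw [← evalAt_diagonal_add]; exact hx r h p
  refine posSemidef_of_re ?_ fun ξ => ?_
  · have := (hr 1 one_pos).1.sub (isHermitian_real_smul_one (𝕜 := 𝕜) (n := n) 1)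
    rwa [add_sub_cancel_left] at this
  · set q := ∑ i, ‖ξ i‖ ^ 2 with hq
    have h2 : 0 ≤ q := Finset.sum_nonneg fun _ _ => sq_nonneg _
    refine le_of_forall_pos_lt_add fun ε hε => ?_
    have h3 := (RCLike.nonneg_iff.mp ((hr (ε / (q + 1)) (by positivity)).dotProduct_mulVec_nonneg
      ξ)).1
    rw [quad_re] at h3
    have h4 : ε / (q + 1) * q < ε := by
      rw [div_mul_eq_mul_div, div_lt_iff₀ (by positivity)]
      nlinarith
    linarith

variable (𝕜)

/-- The operator system `A(K)` of continuous affine functions on `K`, with the pointwise order. -/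
noncomputable def A (K : CompConv.{u}) : OSys.{u} 𝕜 where
  carrier := K.affineFunctions 𝕜
  cone n := {x | ∀ p, (evalAt x p).PosSemidef}
  unit := affineOne K
  isHermitian_of_mem hx := isHermitian_iff_evalAt.mpr fun p => (hx p).1
  zero_mem _ _ := Matrix.PosSemidef.zero
  add_mem hx hy p := (hx p).add (hy p)
  compress_mem α hx p := by
    rw [evalAt_compress]
    exact (hx p).conjTranspose_mul_mul_same α
  proper {n x} hx hy := by
    have hd : ∀ p i j, evalAt x p i j = 0 := fun p i j => by
      have h0 : evalAt x p = 0 := by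
        have hy' : (-(evalAt x p)).PosSemidef := hy p
        open scoped MatrixOrder in
        exact le_antisymm (Matrix.le_iff.mpr (by simpa using hy'))
          (Matrix.le_iff.mpr (by simpa using hx p))
      rw [h0]; rfl
    ext i j p
    exact hd p i j
  orderUnit x hx := affine_orderUnit x hx
  archimedean x hx := affine_archimedean x hx

variable {K L : CompConv.{u}}

/-- Composition with a continuous affine map `K ⟶ L`, as a map `A(L) ⟶ A(K)`. -/
noncomputable def pullback (h : K ⟶ L) : A 𝕜 L ⟶ A 𝕜 K where
  toLinearMap :=
    { toFun := fun f => ⟨f.1.comp h.toMap, fun x y z a b ha hb hab e =>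
        f.2 _ _ _ a b ha hb hab (h.isAffine x y z a b ha hb hab e)⟩
      map_add' := fun _ _ => rfl
      map_smul' := fun _ _ => rfl }
  map_unit := rfl
  map_cone := fun _ _ hx p => hx (h.toMap p)

end CompConv

/-! Everything rests on one obstruction. If four points of a simplex satisfy a + c = b + d, the
supremum of a and b in the lattice spanned by the cone splits a, b and c over common points
(`IsChoquetSimplex.exists_decomposition`). If affine functions k, l with values in [0, 1] behave on
a, b, c like the coordinates on three consecutive corners of a square, the splitting forces b = c,
although l separates them (`IsChoquetSimplex.not_square`).

The tetrahedron maps onto the square so that two opposite edges become the diagonals; hence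
identifying their midpoints gives exactly the square. Each nonexistence claim turns a hypothetical
universal object into a simplex in which the two midpoints are identified and both coordinates of
the square extend. The coordinates are taken with values in Δ¹, itself a Bauer simplex, so that they
are morphisms available for testing universal properties.

For an operator system S the simplex is the state space. A morphism S ⟶ A(Δ³) turns the vertices
into states, and a morphism A(Δ¹) ⟶ S gives a [0, 1]-valued affine function on states
(`OSys.not_square`); no duality between systems and convex sets is needed. Reflectivity is not dual
to the universal arrow from the square: a reflection of A(I²) would correspond to a universal
simplex over the square, and there the uniqueness of factorizations is what identifies the
midpoints. Local presentability fails because cocompleteness would provide the coproduct of A(Δ¹)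
with itself. -/

/-! ### Riesz decomposition in a simplex and the square obstruction. -/

section Simplices

variable {E F : Type*} [AddCommGroup E] [Module ℝ E] [TopologicalSpace E]
  [AddCommGroup F] [Module ℝ F] [TopologicalSpace F]

/-- The Riesz decomposition property of a simplex for two segments with a common midpoint. -/
theorem IsChoquetSimplex.exists_decomposition {K : Set E} (hK : IsChoquetSimplex K)
    {a b c d : E} (ha : a ∈ K) (hb : b ∈ K) (hc : c ∈ K) (hd : d ∈ K) (h : a + c = b + d) :
    ∃ x ∈ K, ∃ y ∈ K, ∃ z ∈ K, ∃ w ∈ K, ∃ s t : ℝ, 0 ≤ s ∧ 0 ≤ t ∧ t + s = 1 ∧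
      a = t • x + s • y ∧ b = t • x + s • z ∧ c = s • z + t • w := by
  have mem : ∀ {p : E}, p ∈ K → ((p, 1) : E × ℝ) ∈ coneOver K :=
    fun {p} hp => ⟨1, zero_le_one, p, hp, by simp⟩
  have diff : ∀ {p : E}, p ∈ K → ∃ q ∈ coneOver K, ∃ r ∈ coneOver K, ((p, 1) : E × ℝ) = q - r :=
    fun {p} hp => ⟨_, mem hp, 0, ⟨0, le_rfl, p, hp, by ext <;> simp⟩, by simp⟩
  -- The supremum of `(a, 1)` and `(b, 1)`. It lies below the two upper bounds `(a, 1) + (b, 1)` and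
  -- `(a, 1) + (c, 1) = (b, 1) + (d, 1)`, and the four resulting differences are the pieces of the
  -- decomposition.
  obtain ⟨⟨v, m⟩, hva, hvb, hv⟩ := hK.2.2 (a, 1) (b, 1) (diff ha) (diff hb)
  obtain ⟨t, ht, x, hx, h1⟩ := hv ((a, 1) + (b, 1)) (by simpa using mem hb) (by simpa using mem ha)
  obtain ⟨t', -, w, hw, h2⟩ := hv ((a, 1) + (c, 1)) (by simpa using mem hc)
    (by rw [show ((a, 1) + (c, 1) : E × ℝ) = (b, 1) + (d, 1) by simp [h]]; simpa using mem hd)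
  obtain ⟨s, hs, z, hz, h3⟩ := hva
  obtain ⟨s', -, y, hy, h4⟩ := hvb
  simp only [Prod.mk_add_mk, Prod.mk_sub_mk, Prod.mk.injEq] at h1 h2 h3 h4
  -- Comparing heights in `E × ℝ`: both `s` and `s'` are `m - 1`, both `t` and `t'` are `2 - m`.
  obtain rfl : s' = s := by linarith
  obtain rfl : t' = t := by linarith
  refine ⟨x, hx, y, hy, z, hz, w, hw, s', t', hs, ht, by linarith, ?_, ?_, ?_⟩
  · rw [← h1.1, ← h4.1]; abel
  · rw [← h1.1, ← h3.1]; abel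
  · rw [← h2.1, ← h3.1]; abel

/-- The vertices of a square cannot be mapped to a simplex in such a way that both coordinate
functions of the square extend to the simplex. -/
theorem IsChoquetSimplex.not_square {K : Set E} (hK : IsChoquetSimplex K) {a b c d : K}
    (h : (a + c : E) = b + d) {k l : K → ℝ}
    (hk : ∀ (x y z : K) (s t : ℝ), 0 ≤ s → 0 ≤ t → s + t = 1 → (z : E) = s • (x : E) + t • (y : E) →
      k z = s * k x + t * k y)
    (hl : ∀ (x y z : K) (s t : ℝ), 0 ≤ s → 0 ≤ t → s + t = 1 → (z : E) = s • (x : E) + t • (y : E) →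
      l z = s * l x + t * l y)
    (hk' : ∀ x, k x ∈ Set.Icc 0 1) (hl' : ∀ x, l x ∈ Set.Icc 0 1)
    (ka : k a = 0) (kb : k b = 1) (lb : l b = 0) (lc : l c = 1) : False := by
  obtain ⟨x, hx, y, hy, z, hz, w, hw, s, t, hs, ht, hst, e1, e2, e3⟩ :=
    hK.exists_decomposition a.2 b.2 c.2 d.2 h
  have k1 := hk ⟨x, hx⟩ ⟨y, hy⟩ a t s ht hs hst e1
  have k2 := hk ⟨x, hx⟩ ⟨z, hz⟩ b t s ht hs hst e2
  have l2 := hl ⟨x, hx⟩ ⟨z, hz⟩ b t s ht hs hst e2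
  have l3 := hl ⟨z, hz⟩ ⟨w, hw⟩ c s t hs ht (by linarith) e3
  have := hk' ⟨x, hx⟩
  have := hk' ⟨y, hy⟩
  have := hk' ⟨z, hz⟩
  have := hl' ⟨x, hx⟩
  have := hl' ⟨z, hz⟩
  have := hl' ⟨w, hw⟩
  simp only [Set.mem_Icc] at *
  -- `k a = 0` forces `t * k x = 0`, so `k b = 1` forces `s * k z = 1` and thus `s = 1`. Then `b`
  -- and `c` both equal `z`, but `l` takes the values 0 and 1 on them.
  have h0 : t = 0 := by nlinarith
  subst h0
  obtain rfl : s = 1 := by linarith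
  linarith

/-! ### Transport of simplices along injective continuous linear maps. -/

theorem mem_coneOver_image {T : E →L[ℝ] F} {K : Set E} {p : F × ℝ} :
    p ∈ coneOver (T '' K) ↔ ∃ q ∈ coneOver K, (T q.1, q.2) = p := by
  constructor
  · rintro ⟨t, ht, _, ⟨x, hx, rfl⟩, rfl⟩
    exact ⟨_, ⟨t, ht, x, hx, rfl⟩, by simp⟩
  · rintro ⟨_, ⟨t, ht, x, hx, rfl⟩, rfl⟩
    exact ⟨t, ht, _, ⟨x, hx, rfl⟩, by simp⟩

theorem mk_mem_coneOver_image {T : E →L[ℝ] F} (hT : Function.Injective T) {K : Set E}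
    {q : E × ℝ} : (T q.1, q.2) ∈ coneOver (T '' K) ↔ q ∈ coneOver K := by
  rw [mem_coneOver_image]
  constructor
  · rintro ⟨q', hq', h⟩
    obtain ⟨h1, h2⟩ := Prod.mk.inj h
    rwa [← Prod.ext (hT h1) h2]
  · exact fun h => ⟨q, h, rfl⟩

theorem sub_mem_coneOver_image {T : E →L[ℝ] F} (hT : Function.Injective T) {K : Set E}
    {p q : E × ℝ} : ((T p.1, p.2) - (T q.1, q.2) : F × ℝ) ∈ coneOver (T '' K) ↔
      p - q ∈ coneOver K := by
  rw [← mk_mem_coneOver_image hT]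
  simp

/-- Injective continuous linear images of simplices are simplices. -/
theorem IsChoquetSimplex.image {K : Set E} (hK : IsChoquetSimplex K) (T : E →L[ℝ] F)
    (hT : Function.Injective T) : IsChoquetSimplex (T '' K) := by
  refine ⟨hK.1.image T.continuous, hK.2.1.linear_image T.toLinearMap, ?_⟩
  rintro _ _ ⟨p, hp, q, hq, rfl⟩ ⟨p', hp', q', hq', rfl⟩
  obtain ⟨p, kp, rfl⟩ := mem_coneOver_image.mp hp
  obtain ⟨q, kq, rfl⟩ := mem_coneOver_image.mp hq
  obtain ⟨p', kp', rfl⟩ := mem_coneOver_image.mp hp'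
  obtain ⟨q', kq', rfl⟩ := mem_coneOver_image.mp hq'
  have hs : ∀ v w : E × ℝ, ((T v.1, v.2) - (T w.1, w.2) : F × ℝ) = (T (v - w).1, (v - w).2) :=
    fun v w => by simp
  obtain ⟨c, h1, h2, h3⟩ := hK.2.2 (p - q) (p' - q') ⟨p, kp, q, kq, rfl⟩ ⟨p', kp', q', kq', rfl⟩
  refine ⟨(T c.1, c.2), ?_, ?_, fun d hd hd' => ?_⟩
  · rwa [hs p q, sub_mem_coneOver_image hT]
  · rwa [hs p' q', sub_mem_coneOver_image hT]
  -- A competing upper bound `d` need not be given as an image, but it differs from the image of `p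
  -- - q` by an element of the image cone, so it is one.
  · obtain ⟨e, -, he⟩ := mem_coneOver_image.mp hd
    obtain rfl : (T (e + (p - q)).1, (e + (p - q)).2) = d := by
      rw [← sub_add_cancel d ((T p.1, p.2) - (T q.1, q.2)), ← he]
      simp
    rw [hs p q, sub_mem_coneOver_image hT] at hd
    rw [hs p' q', sub_mem_coneOver_image hT] at hd'
    rw [sub_mem_coneOver_image hT]
    exact h3 _ hd hd'

/-- Injectivity makes extreme points correspond. Closedness survives through compactness: the closed
set of extreme points of the compact `K` is compact, hence so is its image, which is closed in the
Hausdorff space `F`. -/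
theorem IsBauerSimplex.image [T2Space F] {K : Set E} (hK : IsBauerSimplex K) (T : E →L[ℝ] F)
    (hT : Function.Injective T) : IsBauerSimplex (T '' K) := by
  refine ⟨hK.1.image T hT, ?_⟩
  have hseg : ∀ y z, openSegment ℝ (T y) (T z) = T '' openSegment ℝ y z :=
    fun y z => (image_openSegment ℝ T.toLinearMap.toAffineMap y z).symm
  have h : (T '' K).extremePoints ℝ = T '' K.extremePoints ℝ := by
    ext p
    simp only [mem_extremePoints, Set.mem_image]
    constructor
    · rintro ⟨⟨x, hx, rfl⟩, h⟩
      refine ⟨x, ⟨hx, fun y hy z hz hxyz => ?_⟩, rfl⟩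
      have := h _ ⟨y, hy, rfl⟩ _ ⟨z, hz, rfl⟩
        (by rw [hseg]; exact ⟨x, hxyz, rfl⟩)
      exact ⟨hT this.1, hT this.2⟩
    · rintro ⟨x, ⟨hx, h⟩, rfl⟩
      refine ⟨⟨x, hx, rfl⟩, ?_⟩
      rintro _ ⟨y, hy, rfl⟩ _ ⟨z, hz, rfl⟩ hxyz
      rw [hseg] at hxyz
      obtain ⟨x', hx', e⟩ := hxyz
      obtain rfl := hT e
      exact ⟨congrArg T (h y hy z hz hx').1, congrArg T (h y hy z hz hx').2⟩
  rw [h]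
  exact ((hK.1.1.of_isClosed_subset hK.2 extremePoints_subset).image T.continuous).isClosed

/-! ### The standard simplex is a Bauer simplex. -/

theorem mem_coneOver_stdSimplex {ι : Type*} [Fintype ι] [Nonempty ι] {p : (ι → ℝ) × ℝ} :
    p ∈ coneOver (stdSimplex ℝ ι) ↔ (∀ i, 0 ≤ p.1 i) ∧ ∑ i, p.1 i = p.2 := by
  classical
  constructor
  · rintro ⟨t, ht, x, hx, rfl⟩
    exact ⟨fun i => mul_nonneg ht (hx.1 i), by simp [← Finset.mul_sum, hx.2]⟩
  · rintro ⟨h0, h1⟩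
    have h2 : 0 ≤ p.2 := h1 ▸ Finset.sum_nonneg fun i _ => h0 i
    rcases h2.eq_or_lt with h | h
    · have hp : p.1 = 0 := by
        ext i
        exact (Finset.sum_eq_zero_iff_of_nonneg fun i _ => h0 i).mp (h1.trans h.symm) i
          (Finset.mem_univ i)
      exact ⟨0, le_rfl, Pi.single (Classical.arbitrary ι) 1, single_mem_stdSimplex ℝ _,
        Prod.ext (by simp [hp]) h.symm⟩
    · refine ⟨p.2, h2, p.2⁻¹ • p.1, ⟨fun i => mul_nonneg (inv_nonneg.mpr h2) (h0 i), ?_⟩, ?_⟩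
      · simp [← Finset.mul_sum, h1, h.ne']
      · rw [smul_inv_smul₀ h.ne']

/-- The height of a point of the spanned space is its coordinate sum, so the order is the
coordinatewise one and suprema are coordinatewise. Extreme points are among the finitely many
vertices. -/
theorem isBauerSimplex_stdSimplex (ι : Type*) [Fintype ι] [Nonempty ι] :
    IsBauerSimplex (stdSimplex ℝ ι) := by
  classical
  refine ⟨⟨isCompact_stdSimplex ℝ ι, convex_stdSimplex ℝ ι, ?_⟩, ?_⟩
  · rintro _ _ ⟨p, hp, q, hq, rfl⟩ ⟨p', hp', q', hq', rfl⟩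
    simp only [mem_coneOver_stdSimplex] at hp hq hp' hq' ⊢
    refine ⟨((p - q).1 ⊔ (p' - q').1, ∑ i, ((p - q).1 ⊔ (p' - q').1) i), ⟨fun i => ?_, ?_⟩,
      ⟨fun i => ?_, ?_⟩, fun d hd hd' => ⟨fun i => ?_, ?_⟩⟩
    · simp
    · simp [← hp.2, ← hq.2]
    · simp
    · simp [← hp'.2, ← hq'.2]
    · have h1 := hd.1 i
      have h2 := hd'.1 i
      simp only [Prod.fst_sub, Pi.sub_apply, Pi.sup_apply, sub_nonneg] at h1 h2 ⊢
      exact sup_le h1 h2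
    · have h := hd.2
      simp only [Prod.fst_sub, Prod.snd_sub, Pi.sub_apply, Finset.sum_sub_distrib, hp.2, hq.2] at h
      simp only [Prod.fst_sub, Prod.snd_sub, Pi.sub_apply, Finset.sum_sub_distrib]
      linarith
  · rw [← convexHull_basis_eq_stdSimplex]
    exact ((Set.finite_range _).subset extremePoints_convexHull_subset).isClosed

end Simplices

/-! ### Maps between compact convex sets -/

namespace CompConv

/-- The two-point condition says that the graph of `f` is convex, and convex sets contain all finite
convex combinations. -/
theorem IsAffine.map_sum {K : CompConv.{u}} {F : Type*} [AddCommGroup F] [Module ℝ F]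
    {f : K.carrier → F} (hf : K.IsAffine f) {ι : Type*} [Fintype ι] {w : ι → ℝ}
    (hw : w ∈ stdSimplex ℝ ι) (x : ι → K.carrier) {z : K.carrier}
    (hz : (z : K.V) = ∑ i, w i • (x i : K.V)) : f z = ∑ i, w i • f (x i) := by
  have hc : Convex ℝ {p : K.V × F | ∃ y : K.carrier, p = (↑y, f y)} := by
    rintro _ ⟨y, rfl⟩ _ ⟨y', rfl⟩ a b ha hb hab
    refine ⟨⟨_, K.convex y.2 y'.2 ha hb hab⟩, ?_⟩
    rw [hf y y' ⟨_, K.convex y.2 y'.2 ha hb hab⟩ a b ha hb hab rfl]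
    rfl
  obtain ⟨y, hy⟩ := hc.sum_mem (t := Finset.univ) (w := w) (z := fun i => ((x i : K.V), f (x i)))
    (fun i _ => hw.1 i) hw.2 (fun i _ => ⟨x i, rfl⟩)
  have h1 := congrArg Prod.fst hy
  have h2 := congrArg Prod.snd hy
  simp only [Prod.fst_sum, Prod.snd_sum, Prod.smul_fst, Prod.smul_snd] at h1 h2
  rw [h2, Subtype.ext (hz.trans h1)]

theorem IsAffine.map_midpoint {K : CompConv.{u}} {F : Type*} [AddCommGroup F] [Module ℝ F]
    {f : K.carrier → F} (hf : K.IsAffine f) {x y z : K.carrier}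
    (hz : (z : K.V) = midpoint ℝ (x : K.V) y) : f z = midpoint ℝ (f x) (f y) := by
  rw [midpoint_eq_smul_add, smul_add] at hz ⊢
  exact hf x y z _ _ (by norm_num) (by norm_num) (by norm_num) hz

/-- The `i`-th vertex of a standard simplex. -/
noncomputable def vertex {n : ℕ} (i : Fin (n + 1)) : (simplex.{u} n).carrier :=
  ⟨Pi.single (ULift.up i) 1, single_mem_stdSimplex ℝ _⟩

theorem eq_sum_vertex {n : ℕ} (z : (simplex.{u} n).carrier) :
    (z : (simplex.{u} n).V) = ∑ i : ULift.{u} (Fin (n + 1)), z.1 i • (vertex.{u} i.down).1 := by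
  refine (pi_eq_sum_univ' z.1).trans (Finset.sum_congr rfl fun i _ => congrArg (z.1 i • ·) ?_)
  funext j
  change (Pi.single i 1 : ULift.{u} (Fin (n + 1)) → ℝ) j =
    (Pi.single i 1 : ULift.{u} (Fin (n + 1)) → ℝ) j
  rw [Pi.single_apply]

theorem IsAffine.eq_sum_vertex {n : ℕ} {F : Type*} [AddCommGroup F] [Module ℝ F]
    {f : (simplex.{u} n).carrier → F} (hf : (simplex n).IsAffine f)
    (z : (simplex.{u} n).carrier) :
    f z = ∑ i : ULift.{u} (Fin (n + 1)), z.1 i • f (vertex i.down) :=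
  hf.map_sum z.2 _ (CompConv.eq_sum_vertex z)

/-- A coordinate function of a standard simplex. -/
def coord {n : ℕ} (i : Fin (n + 1)) : C((simplex.{u} n).carrier, ℝ) where
  toFun x := x.1 (ULift.up i)
  continuous_toFun := (continuous_apply (ULift.up i)).comp continuous_subtype_val

theorem isAffine_coord {n : ℕ} (i : Fin (n + 1)) : (simplex.{u} n).IsAffine (coord.{u} i) :=
  fun _ _ _ _ _ _ _ _ h => congrFun h (ULift.up i)

theorem coord_nonneg {n : ℕ} (i : Fin (n + 1)) (x : (simplex.{u} n).carrier) : 0 ≤ coord i x :=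
  x.2.1 _

theorem sum_coord {n : ℕ} (x : (simplex.{u} n).carrier) : ∑ i, coord i x = 1 :=
  (Equiv.ulift.symm.sum_comp x.1).trans x.2.2

theorem coord_vertex {n : ℕ} (i j : Fin (n + 1)) :
    coord.{u} i (vertex j) = if i = j then 1 else 0 := by
  change (Pi.single (ULift.up j) (1 : ℝ) : ULift.{u} (Fin (n + 1)) → ℝ) (ULift.up i) = _
  simp [Pi.single_apply]

/-- A continuous affine function with values in `[0, 1]` as a map to the segment `Δ¹`. -/
noncomputable def toSegment {K : CompConv.{u}} (k : C(K.carrier, ℝ)) (hk : K.IsAffine k)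
    (hk' : ∀ x, k x ∈ Set.Icc 0 1) : K ⟶ simplex.{u} 1 where
  toMap :=
    { toFun := fun x => ⟨fun i => if i.down = 0 then 1 - k x else k x, by
        refine ⟨fun i => ?_, ?_⟩
        · have := hk' x
          dsimp only
          split_ifs <;> linarith [this.1, this.2]
        · rw [← Equiv.ulift.symm.sum_comp]
          simp [Fin.sum_univ_two]⟩
      continuous_toFun := by
        refine Continuous.subtype_mk (continuous_pi fun i => ?_) _
        split_ifs <;> fun_prop }
  isAffine := fun x y z a b ha hb hab h => by
    have := hk x y z a b ha hb hab h
    refine funext fun i => ?_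
    change (if i.down = 0 then 1 - k z else k z) =
      a * (if i.down = 0 then 1 - k x else k x) + b * (if i.down = 0 then 1 - k y else k y)
    rw [this]
    split_ifs
    · simp only [smul_eq_mul]
      linear_combination (-1 : ℝ) * hab
    · rfl

/-- The coordinate functions of the square. -/
noncomputable def squareCoord (i : Fin 2) : square.{u} ⟶ simplex.{u} 1 :=
  toSegment ⟨fun x => x.1 (ULift.up i),
    (continuous_apply (ULift.up i)).comp continuous_subtype_val⟩
    (fun _ _ _ _ _ _ _ _ h => congrFun h (ULift.up i)) fun x => ⟨x.2.1 _, x.2.2 _⟩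

/-! ### The square as a quotient of the tetrahedron. -/

/-- The map from the tetrahedron to the square that maps vertices to vertices and
identifies the midpoints of two opposite edges. -/
noncomputable def toSquare : simplex.{u} 3 ⟶ square.{u} where
  toMap :=
    { toFun := fun x =>
        -- The vertices 0, 1, 2, 3 go to (0,0), (1,1), (1,0), (0,1), so the edges {0, 1} and {2, 3}
        -- become the diagonals.
        ⟨fun i => coord 1 x + coord (if i.down = 0 then 2 else 3) x, by
          have h := sum_coord x
          have h0 := fun i => coord_nonneg i x
          rw [Fin.sum_univ_four] at h
          refine ⟨fun i => add_nonneg (h0 _) (h0 _), fun i => ?_⟩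
          dsimp only [Pi.one_apply]
          split_ifs <;> linarith [h0 0, h0 2, h0 3]⟩
      continuous_toFun := by
        refine Continuous.subtype_mk (continuous_pi fun i => ?_) _
        exact (coord _).continuous.add (coord _).continuous }
  isAffine := fun x y z a b ha hb hab h => by
    refine funext fun i => ?_
    change coord 1 z + coord _ z = a * (coord 1 x + coord _ x) + b * (coord 1 y + coord _ y)
    rw [isAffine_coord _ x y z a b ha hb hab h, isAffine_coord _ x y z a b ha hb hab h]
    simp only [smul_eq_mul]
    ring

theorem coord_edgeMidpoint (i j k : Fin 4) :
    coord.{u} k (edgeMidpoint i j) =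
      midpoint ℝ (if k = i then 1 else 0) (if k = j then 1 else 0) := by
  rw [(isAffine_coord k).map_midpoint (x := vertex i) (y := vertex j) rfl, coord_vertex,
    coord_vertex]

theorem toSquare_edgeMidpoint :
    toSquare.toMap (edgeMidpoint.{u} 0 1) = toSquare.toMap (edgeMidpoint.{u} 2 3) := by
  refine Subtype.ext (funext fun i => ?_)
  change coord _ _ + coord _ _ = coord _ _ + coord _ _
  simp only [coord_edgeMidpoint, midpoint_eq_smul_add]
  by_cases hi : i.down = 0 <;> norm_num +decide [hi]

theorem midF_toSquare : midF.{u} ≫ toSquare = midG ≫ toSquare :=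
  Hom.ext (ContinuousMap.ext fun _ => toSquare_edgeMidpoint)

theorem toSquare_surjective : Function.Surjective (toSquare.{u}).toMap := by
  intro y
  set a := y.1 (.up 0) with ha
  set b := y.1 (.up 1) with hb
  have ha0 : 0 ≤ a := y.2.1 _
  have hb0 : 0 ≤ b := y.2.1 _
  have ha1 : 0 ≤ 1 - a := sub_nonneg.mpr (y.2.2 _)
  have hb1 : 0 ≤ 1 - b := sub_nonneg.mpr (y.2.2 _)
  -- The weights of the four corners in bilinear interpolation, in the order of the vertices.
  refine ⟨⟨fun i => ![(1 - a) * (1 - b), a * b, a * (1 - b), (1 - a) * b] i.down, fun i => ?_, ?_⟩,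
    ?_⟩
  · obtain ⟨i⟩ := i
    fin_cases i <;> simp <;> positivity
  · rw [← Equiv.ulift.symm.sum_comp, Fin.sum_univ_four]
    simp
    ring
  · refine Subtype.ext (funext fun ⟨i⟩ => ?_)
    fin_cases i
    · change a * b + a * (1 - b) = a
      ring
    · change a * b + (1 - a) * b = b
      ring

instance : Epi toSquare.{u} where
  left_cancellation g h e := Hom.ext <| ContinuousMap.ext fun y => by
    obtain ⟨x, rfl⟩ := toSquare_surjective y
    exact congrArg (fun f => f.toMap x) e

/-- A map that identifies the midpoints of two opposite edges agrees on the sums of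
their end points. -/
theorem vertex_add_vertex {L : CompConv.{u}} {h : simplex.{u} 3 ⟶ L}
    (w : midF ≫ h = midG ≫ h) :
    (h.toMap (vertex 0) : L.V) + h.toMap (vertex 1) =
      h.toMap (vertex 2) + h.toMap (vertex 3) := by
  have e : h.toMap (edgeMidpoint 0 1) = h.toMap (edgeMidpoint 2 3) :=
    congrArg (fun f => f.toMap (vertex 0)) w
  have e' := congrArg (Subtype.val) e
  rw [h.isAffine.map_midpoint (x := vertex 0) (y := vertex 1)
      (z := edgeMidpoint 0 1) rfl,
    h.isAffine.map_midpoint (x := vertex 2) (y := vertex 3)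
      (z := edgeMidpoint 2 3) rfl, midpoint_eq_smul_add,
    midpoint_eq_smul_add] at e'
  exact smul_right_injective _ (by norm_num : (⅟2 : ℝ) ≠ 0) e'

/-- By `vertex_add_vertex` the image of vertex 1 is determined by the other three, so `h` depends
only on the two coordinates of the square. The right-hand side serves as the induced map, with
continuity and affinity visible and no choice of preimages. -/
theorem eq_toSquare {L : CompConv.{u}} {h : simplex.{u} 3 ⟶ L} (w : midF ≫ h = midG ≫ h)
    (x : (simplex.{u} 3).carrier) :
    (h.toMap x : L.V) = h.toMap (vertex 0) +
      (((toSquare.toMap x).1 (.up 0) : ℝ) • ((h.toMap (vertex 2) : L.V) - h.toMap (vertex 0)) +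
        ((toSquare.toMap x).1 (.up 1) : ℝ) •
          ((h.toMap (vertex 3) : L.V) - h.toMap (vertex 0))) := by
  have e : (h.toMap x : L.V) = ∑ i : Fin 4, coord i x • (h.toMap (vertex i) : L.V) :=
    (h.isAffine.eq_sum_vertex x).trans (Equiv.ulift.symm.sum_comp _).symm
  change _ = _ + ((coord 1 x + coord 2 x) • _ + (coord 1 x + coord 3 x) • _)
  have h1 := vertex_add_vertex w
  have h2 := sum_coord x
  rw [Fin.sum_univ_four] at e h2
  have h3 : coord 0 x = 1 - coord 1 x - coord 2 x - coord 3 x := by linarith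
  rw [e, eq_sub_of_add_eq' h1, h3]
  module

/-- The map that a continuous affine map on the tetrahedron induces on the square. -/
noncomputable def descSquare {L : CompConv.{u}} (h : simplex.{u} 3 ⟶ L)
    (w : midF ≫ h = midG ≫ h) : square.{u} ⟶ L where
  toMap :=
    { toFun := fun y => ⟨h.toMap (vertex 0) +
          ((y.1 (.up 0) : ℝ) • ((h.toMap (vertex 2) : L.V) - h.toMap (vertex 0)) +
            (y.1 (.up 1) : ℝ) • ((h.toMap (vertex 3) : L.V) - h.toMap (vertex 0))), by
        obtain ⟨x, rfl⟩ := toSquare_surjective y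
        rw [← eq_toSquare w]
        exact (h.toMap x).2⟩
      continuous_toFun := by
        have hc : ∀ i, Continuous fun y : square.{u}.carrier => y.1 (.up i) :=
          fun i => (continuous_apply (ULift.up i)).comp continuous_subtype_val
        exact Continuous.subtype_mk (continuous_const.add
          (((hc 0).smul continuous_const).add ((hc 1).smul continuous_const))) _ }
  isAffine := fun x y z a b _ _ hab e => by
    have e' : ∀ i, z.1 i = a * x.1 i + b * y.1 i := congrFun e
    simp only [ContinuousMap.coe_mk, e']
    obtain rfl := eq_sub_of_add_eq hab
    module

/-- The square is the coequalizer of the midpoints of two opposite edges of the tetrahedron. -/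
noncomputable def isColimitToSquare : IsColimit (Cofork.ofπ toSquare.{u} midF_toSquare) :=
  Cofork.IsColimit.mk _ (fun s => descSquare s.π s.condition)
    (fun s => Hom.ext <| ContinuousMap.ext fun x =>
      Subtype.ext (eq_toSquare s.condition x).symm)
    fun s m hm => by
      rw [← cancel_epi toSquare]
      refine hm.trans (Hom.ext <| ContinuousMap.ext fun x =>
        Subtype.ext (eq_toSquare s.condition x))

theorem isBauer_simplex (n : ℕ) : IsBauer (simplex.{u} n) := isBauerSimplex_stdSimplex _

/-- A simplex in which the midpoints of two opposite edges of the tetrahedron are identified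
does not admit extensions of the coordinate functions of the square. -/
theorem IsChoquet.not_square {S : CompConv.{u}} (hS : IsChoquet S) (h : simplex.{u} 3 ⟶ S)
    (w : midF ≫ h = midG ≫ h) (k l : S ⟶ simplex.{u} 1)
    (hk : h ≫ k = toSquare ≫ squareCoord 0) (hl : h ≫ l = toSquare ≫ squareCoord 1) : False := by
  have aff : ∀ k : S ⟶ simplex.{u} 1, S.IsAffine fun x => coord 1 (k.toMap x) :=
    fun k x y z a b ha hb hab e =>
      isAffine_coord 1 _ _ _ a b ha hb hab (k.isAffine x y z a b ha hb hab e)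
  have mem : ∀ x : (simplex.{u} 1).carrier, coord 1 x ∈ Set.Icc 0 1 := fun x => by
    have := sum_coord x
    rw [Fin.sum_univ_two] at this
    exact ⟨coord_nonneg 1 x, by linarith [coord_nonneg 0 x]⟩
  have hk' : ∀ i, coord 1 (k.toMap (h.toMap (vertex i))) =
      coord 1 (vertex i) + coord 2 (vertex i) :=
    fun i => congrArg (fun f => coord 1 (f.toMap (vertex i))) hk
  have hl' : ∀ i, coord 1 (l.toMap (h.toMap (vertex i))) =
      coord 1 (vertex i) + coord 3 (vertex i) :=
    fun i => congrArg (fun f => coord 1 (f.toMap (vertex i))) hl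
  refine IsChoquetSimplex.not_square hS (vertex_add_vertex w) (aff k) (aff l)
    (fun _ => mem _) (fun _ => mem _) ?_ ?_ ?_ ?_
  · simp [hk', coord_vertex]
  · simp [hk', coord_vertex]
  · simp [hl', coord_vertex]
  · simp [hl', coord_vertex]

/-! ### Missing universal arrows and coequalizers among simplices. -/

variable {P : ObjectProperty CompConv.{u}}

/-- As Δ¹ lies in `P`, both coordinates of the square would factor through the universal arrow; the
uniqueness of the factorizations plays no role. -/
theorem isEmpty_isInitial (hP : P ≤ IsChoquet) (h₁ : P (simplex 1))
    (U : StructuredArrow square.{u} P.ι) : IsEmpty (IsInitial U) := by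
  refine ⟨fun hU => ?_⟩
  have fac : ∀ i, U.hom ≫ (hU.to (StructuredArrow.mk (T := P.ι)
      (show square.{u} ⟶ P.ι.obj ⟨simplex 1, h₁⟩ from squareCoord i))).right.hom = squareCoord i :=
    fun i => StructuredArrow.w (hU.to _)
  refine (hP _ U.right.property).not_square (toSquare ≫ U.hom) ?_ _ _
    ((Category.assoc _ _ _).trans (congrArg (toSquare ≫ ·) (fac 0)))
    ((Category.assoc _ _ _).trans (congrArg (toSquare ≫ ·) (fac 1)))
  rw [← Category.assoc, midF_toSquare, Category.assoc]

theorem not_hasCoequalizer (hP : P ≤ IsChoquet) (h₀ : P (simplex 0)) (h₁ : P (simplex 1))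
    (h₃ : P (simplex 3)) :
    ¬ HasCoequalizer
      (ObjectProperty.homMk midF.{u} : (⟨_, h₀⟩ : P.FullSubcategory) ⟶ ⟨_, h₃⟩)
      (ObjectProperty.homMk midG.{u}) := by
  intro H
  let p (i : Fin 2) : (⟨_, h₃⟩ : P.FullSubcategory) ⟶ ⟨_, h₁⟩ :=
    ObjectProperty.homMk (toSquare ≫ squareCoord i)
  let f : (⟨_, h₀⟩ : P.FullSubcategory) ⟶ ⟨_, h₃⟩ := ObjectProperty.homMk midF.{u}
  let g : (⟨_, h₀⟩ : P.FullSubcategory) ⟶ ⟨_, h₃⟩ := ObjectProperty.homMk midG.{u}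
  have : HasCoequalizer f g := H
  have w : ∀ i, f ≫ p i = g ≫ p i :=
    fun i => ObjectProperty.hom_ext _ (congrArg (· ≫ squareCoord i) midF_toSquare)
  exact (hP _ (coequalizer f g).property).not_square (coequalizer.π f g).hom
    (congrArg (fun f => f.hom) (coequalizer.condition f g))
    (coequalizer.desc (p 0) (w 0)).hom (coequalizer.desc (p 1) (w 1)).hom
    (congrArg (fun f => f.hom) (coequalizer.π_desc (p 0) (w 0)))
    (congrArg (fun f => f.hom) (coequalizer.π_desc (p 1) (w 1)))

end CompConv

/-! ### Function systems and their states -/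

section Matrices

variable {𝕜 : Type} [RCLike 𝕜]

theorem posSemidef_fin_one {a : 𝕜} : (!![a] : Matrix (Fin 1) (Fin 1) 𝕜).PosSemidef ↔ 0 ≤ a := by
  rw [show (!![a] : Matrix (Fin 1) (Fin 1) 𝕜) = Matrix.diagonal fun _ => a by
    ext i j; fin_cases i; fin_cases j; rfl, Matrix.posSemidef_diagonal_iff]
  exact ⟨fun h => h 0, fun h _ => h⟩

/-- One direction is the determinant; in the other, the quadratic form is at least `r * (‖ξ 0‖ - ‖ξ
1‖) ^ 2`. This identifies the order-unit norm of `A(K)` with the supremum norm. -/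
theorem posSemidef_norm_le {r : ℝ} (hr : 0 < r) {a : 𝕜} :
    (!![(r : 𝕜), a; star a, (r : 𝕜)] : Matrix (Fin 2) (Fin 2) 𝕜).PosSemidef ↔ ‖a‖ ≤ r := by
  constructor
  · intro h
    have := h.det_nonneg
    rw [Matrix.det_fin_two_of, RCLike.star_def, RCLike.mul_conj] at this
    have h2 : (0 : 𝕜) ≤ ((r * r - ‖a‖ ^ 2 : ℝ) : 𝕜) := by push_cast; exact this
    have h3 : 0 ≤ r * r - ‖a‖ ^ 2 := (RCLike.ofReal_nonneg (K := 𝕜)).mp h2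
    nlinarith [norm_nonneg a]
  · intro h
    refine CompConv.posSemidef_of_re (𝕜 := 𝕜) ?_ fun ξ => ?_
    · ext i j
      fin_cases i <;> fin_cases j <;> simp
    · have e : (!![(r : 𝕜), a; star a, (r : 𝕜)] : Matrix (Fin 2) (Fin 2) 𝕜) =
          (r : 𝕜) • (1 : Matrix (Fin 2) (Fin 2) 𝕜) + !![0, a; star a, 0] := by
        ext i j
        fin_cases i <;> fin_cases j <;> simp [RCLike.real_smul_eq_coe_mul]
      rw [e, CompConv.quad_re, Fin.sum_univ_two]
      have h1 : dotProduct (star ξ) (Matrix.mulVec !![0, a; star a, 0] ξ) =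
          star (ξ 0) * (a * ξ 1) + star (ξ 1) * (star a * ξ 0) := by
        simp [dotProduct, Matrix.mulVec, Fin.sum_univ_two]
      have h2 : ‖star (ξ 0) * (a * ξ 1) + star (ξ 1) * (star a * ξ 0)‖ ≤
          2 * (r * (‖ξ 0‖ * ‖ξ 1‖)) := by
        refine (norm_add_le _ _).trans ?_
        simp only [norm_mul, norm_star]
        nlinarith [mul_le_mul_of_nonneg_right h (mul_nonneg (norm_nonneg (ξ 0)) (norm_nonneg (ξ 1)))]
      have h3 := (abs_le.mp ((RCLike.abs_re_le_norm _).trans h2)).1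
      rw [h1]
      nlinarith [mul_nonneg hr.le (sq_nonneg (‖ξ 0‖ - ‖ξ 1‖))]

end Matrices

namespace CompConv

variable {𝕜 : Type} [RCLike 𝕜]

theorem normLE_A {K : CompConv.{u}} {f : K.affineFunctions 𝕜} {r : ℝ} (hr : 0 < r) :
    (A 𝕜 K).NormLE f r ↔ ‖f.1‖ ≤ r := by
  rw [ContinuousMap.norm_le _ hr.le]
  refine forall_congr' fun p => ?_
  rw [← posSemidef_norm_le hr]
  refine iff_of_eq (congrArg _ ?_)
  ext i j
  fin_cases i <;> fin_cases j
  · exact mul_one (r : 𝕜)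
  · rfl
  · rfl
  · exact mul_one (r : 𝕜)

theorem isClosed_affineFunctions (K : CompConv.{u}) :
    IsClosed (K.affineFunctions 𝕜 : Set C(K.carrier, 𝕜)) := by
  have : (K.affineFunctions 𝕜 : Set C(K.carrier, 𝕜)) = {f : C(K.carrier, 𝕜) | K.IsAffine f} := rfl
  rw [this]
  simp only [IsAffine, Set.ofPred_forall]
  refine isClosed_iInter fun x => isClosed_iInter fun y => isClosed_iInter fun z =>
    isClosed_iInter fun a => isClosed_iInter fun b => isClosed_iInter fun _ =>
    isClosed_iInter fun _ => isClosed_iInter fun _ => isClosed_iInter fun _ => ?_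
  refine isClosed_eq (by fun_prop) ?_
  exact ((continuous_eval_const x).const_smul a).add ((continuous_eval_const y).const_smul b)

/-- The affine functions are closed in the complete space `C(K)`, whose norm is the one defined by
the order; the inclusion into `C(K)` is the required embedding. -/
theorem isFunctionSystem_A (K : CompConv.{u}) : (A 𝕜 K).IsFunctionSystem := by
  constructor
  · intro s hs
    have hc : CauchySeq fun n => (s n : K.affineFunctions 𝕜).1 := by
      refine Metric.cauchySeq_iff.mpr fun ε hε => ?_
      obtain ⟨N, hN⟩ := hs (ε / 2) (half_pos hε)
      refine ⟨N, fun m hm n hn => ?_⟩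
      have := (normLE_A (half_pos hε)).mp (hN m hm n hn)
      rw [dist_eq_norm]
      exact this.trans_lt (half_lt_self hε)
    obtain ⟨a, ha⟩ := cauchySeq_tendsto_of_complete hc
    have hmem := (isClosed_affineFunctions (𝕜 := 𝕜) K).mem_of_tendsto ha
      (Filter.Eventually.of_forall fun n => (s n : K.affineFunctions 𝕜).2)
    refine ⟨(⟨a, hmem⟩ : K.affineFunctions 𝕜), fun ε hε => ?_⟩
    obtain ⟨N, hN⟩ := Metric.tendsto_atTop.mp ha ε hε
    refine ⟨N, fun n hn => (normLE_A hε).mpr ?_⟩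
    have := hN n hn
    rw [dist_eq_norm] at this
    exact this.le
  · exact ⟨K.carrier, inferInstance, inferInstance, inferInstance, (K.affineFunctions 𝕜).subtype,
      Subtype.val_injective, rfl, fun n x => Iff.rfl⟩

theorem singleton_mem_cone_A {K : CompConv.{u}} {f : K.affineFunctions 𝕜} :
    !![f] ∈ (A 𝕜 K).cone 1 ↔ ∀ p, 0 ≤ f.1 p := by
  refine forall_congr' fun p => ?_
  rw [← posSemidef_fin_one]
  refine iff_of_eq (congrArg _ ?_)
  ext i j
  fin_cases i; fin_cases j; rfl

/-! ### The states of `A(Δⁿ)`. -/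

variable (𝕜) in
/-- A coordinate function of a standard simplex, as an element of the function system. -/
noncomputable def coordA {n : ℕ} (i : Fin (n + 1)) : (simplex.{u} n).affineFunctions 𝕜 :=
  ⟨⟨fun x => (coord i x : 𝕜), RCLike.continuous_ofReal.comp (coord i).continuous⟩,
    fun x y z a b ha hb hab h => by
      have := isAffine_coord i x y z a b ha hb hab h
      simp only [ContinuousMap.coe_mk, this, smul_eq_mul, RCLike.real_smul_eq_coe_mul]
      push_cast
      rfl⟩

theorem coordA_mem_cone {n : ℕ} (i : Fin (n + 1)) :
    !![coordA.{u} 𝕜 i] ∈ (A 𝕜 (simplex.{u} n)).cone 1 :=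
  singleton_mem_cone_A.mpr fun p => RCLike.ofReal_nonneg.mpr (coord_nonneg i p)

theorem sum_coordA (n : ℕ) : ∑ i, coordA.{u} (n := n) 𝕜 i = affineOne _ := by
  refine Subtype.ext (ContinuousMap.ext fun p => ?_)
  simp only [Submodule.coe_sum, ContinuousMap.sum_apply]
  change ∑ i, (coord i p : 𝕜) = 1
  rw [← RCLike.ofReal_sum, sum_coord, RCLike.ofReal_one]

theorem eq_sum_coordA {n : ℕ} (f : (simplex.{u} n).affineFunctions 𝕜) :
    f = ∑ i, f.1 (vertex i) • coordA 𝕜 i := by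
  refine Subtype.ext (ContinuousMap.ext fun p => ?_)
  simp only [Submodule.coe_sum, ContinuousMap.sum_apply]
  rw [IsAffine.eq_sum_vertex f.2 p]
  refine (Equiv.ulift.symm.sum_comp _).symm.trans (Finset.sum_congr rfl fun i _ => ?_)
  rw [RCLike.real_smul_eq_coe_mul, mul_comm]
  rfl

variable (𝕜) in
/-- The embedding of a standard simplex into the dual of its function system. -/
noncomputable def evalL (n : ℕ) :
    (ULift.{u} (Fin (n + 1)) → ℝ) →L[ℝ] ((A 𝕜 (simplex.{u} n)).carrier → 𝕜) where
  toFun v f := ∑ i, v i • (f : (simplex.{u} n).affineFunctions 𝕜).1 (vertex i.down)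
  map_add' v w := by
    funext f
    simp only [Pi.add_apply, add_smul, Finset.sum_add_distrib]
  map_smul' c v := by
    funext f
    simp only [Pi.smul_apply, smul_assoc, Finset.smul_sum, RingHom.id_apply]
  cont := by
    refine continuous_pi fun f => ?_
    fun_prop

theorem evalL_coordA (n : ℕ) (v : ULift.{u} (Fin (n + 1)) → ℝ) (i : Fin (n + 1)) :
    evalL 𝕜 n v (coordA 𝕜 i : (simplex.{u} n).affineFunctions 𝕜) = (v (.up i) : 𝕜) := by
  change ∑ j, v j • (coord i (vertex j.down) : 𝕜) = _
  rw [Finset.sum_eq_single (ULift.up i)]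
  · rw [coord_vertex, if_pos rfl, RCLike.real_smul_eq_coe_mul, RCLike.ofReal_one, mul_one]
  · intro j _ hj
    rw [coord_vertex, if_neg fun h => hj (by rw [h]), RCLike.ofReal_zero, smul_zero]
  · simp

theorem evalL_injective (n : ℕ) : Function.Injective (evalL.{u} 𝕜 n) := by
  intro v w h
  funext i
  have := congrFun h (coordA 𝕜 i.down : (simplex.{u} n).affineFunctions 𝕜)
  rw [evalL_coordA, evalL_coordA] at this
  exact RCLike.ofReal_injective this

/-- The coordinate functions span `A(Δⁿ)`, are positive and sum to the unit, so the values of a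
state on them are the barycentric coordinates of the point that represents it. -/
theorem exists_eq_evalL {n : ℕ} (φ : (simplex.{u} n).affineFunctions 𝕜 →ₗ[𝕜] 𝕜)
    (h1 : φ (affineOne _) = 1) (h0 : ∀ i, 0 ≤ φ (coordA 𝕜 i)) :
    ∃ v ∈ (simplex.{u} n).carrier, ∀ f, evalL 𝕜 n v f = φ f := by
  -- Nonnegative elements of `𝕜` are real, so passing to real parts loses nothing.
  have hre : ∀ i, ((RCLike.re (φ (coordA 𝕜 i)) : ℝ) : 𝕜) = φ (coordA 𝕜 i) := fun i =>
    RCLike.conj_eq_iff_re.mp (RCLike.conj_eq_iff_im.mpr (RCLike.nonneg_iff.mp (h0 i)).2)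
  refine ⟨fun i => RCLike.re (φ (coordA 𝕜 i.down)),
    ⟨fun i => (RCLike.nonneg_iff.mp (h0 i.down)).1, ?_⟩, ?_⟩
  · refine (Equiv.ulift.symm.sum_comp _).symm.trans ?_
    simp only [Equiv.ulift_symm_down]
    rw [← map_sum, ← map_sum, sum_coordA, h1, RCLike.one_re]
  · intro f
    change ∑ i : ULift.{u} (Fin (n + 1)), RCLike.re (φ (coordA 𝕜 i.down)) •
      (f : (simplex.{u} n).affineFunctions 𝕜).1 (vertex i.down) = φ f
    rw [← Equiv.ulift.symm.sum_comp]
    conv_rhs => rw [eq_sum_coordA f, map_sum]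
    refine Finset.sum_congr rfl fun i _ => ?_
    rw [map_smul, Equiv.ulift_symm_down, RCLike.real_smul_eq_coe_mul, hre, smul_eq_mul, mul_comm]

theorem stateSpace_A_simplex (n : ℕ) :
    (A 𝕜 (simplex.{u} n)).stateSpace = evalL 𝕜 n '' (simplex.{u} n).carrier := by
  ext φ
  constructor
  · rintro ⟨φ, rfl, h1, h0⟩
    obtain ⟨v, hv, h⟩ := exists_eq_evalL φ h1 fun i => h0 _ (coordA_mem_cone i)
    exact ⟨v, hv, funext h⟩
  · rintro ⟨v, hv, rfl⟩
    let φ : (simplex.{u} n).affineFunctions 𝕜 →ₗ[𝕜] 𝕜 :=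
      ∑ i : ULift.{u} (Fin (n + 1)), v i • ((ContinuousMap.evalCLM 𝕜 (vertex i.down)).toLinearMap ∘ₗ
        ((simplex.{u} n).affineFunctions 𝕜).subtype)
    have hφ : ∀ f, φ f = ∑ i, v i • f.1 (vertex i.down) := fun f => LinearMap.sum_apply _ _ _
    refine ⟨φ, funext hφ, (hφ _).trans ?_, fun f hf => (hφ f).symm ▸ ?_⟩
    · change ∑ i, v i • (1 : 𝕜) = 1
      rw [← Finset.sum_smul, hv.2, one_smul]
    · exact Finset.sum_nonneg fun i _ =>
        smul_nonneg (hv.1 i) (singleton_mem_cone_A.mp hf (vertex i.down))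

theorem isBauerSystem_A_simplex (n : ℕ) : (A 𝕜 (simplex.{u} n)).IsBauerSystem := by
  refine ⟨isFunctionSystem_A _, ?_⟩
  rw [stateSpace_A_simplex]
  exact (isBauer_simplex n).image _ (evalL_injective n)

theorem isSimplexSystem_A_simplex (n : ℕ) : (A 𝕜 (simplex.{u} n)).IsSimplexSystem :=
  ⟨isFunctionSystem_A _, (isBauerSystem_A_simplex n).2.1⟩

end CompConv

/-! ### The square obstruction for operator systems. -/

namespace OSys

open CompConv

variable {𝕜 : Type} [RCLike 𝕜]

theorem Hom.singleton_mem_cone {S T : OSys.{u} 𝕜} (h : S ⟶ T) {s : S.carrier}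
    (hs : !![s] ∈ S.cone 1) : !![h.toLinearMap s] ∈ T.cone 1 := by
  have := h.map_cone 1 _ hs
  rwa [show (!![s] : Matrix (Fin 1) (Fin 1) S.carrier).map h.toLinearMap = !![h.toLinearMap s] by
    ext i j; fin_cases i; fin_cases j; rfl] at this

/-- The continuous affine function to which a morphism to `A(K)` sends an element. -/
noncomputable def Hom.affineFunction {S : OSys.{u} 𝕜} {K : CompConv.{u}} (h : S ⟶ A 𝕜 K)
    (s : S.carrier) :
    K.affineFunctions 𝕜 :=
  h.toLinearMap s

/-- The state of `S` obtained by evaluating a morphism `S ⟶ A(K)` at a point. -/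
noncomputable def evalState {S : OSys.{u} 𝕜} {K : CompConv.{u}} (h : S ⟶ A 𝕜 K) (p : K.carrier) :
    S.stateSpace :=
  ⟨fun s => (Hom.affineFunction h s).1 p,
    ⟨⟨⟨fun s => (Hom.affineFunction h s).1 p,
      fun s t => congrArg (fun f : K.affineFunctions 𝕜 => f.1 p) (h.toLinearMap.map_add s t)⟩,
      fun c s => congrArg (fun f : K.affineFunctions 𝕜 => f.1 p) (h.toLinearMap.map_smul c s)⟩,
      rfl, congrArg (fun f : K.affineFunctions 𝕜 => f.1 p) h.map_unit,
      fun _ hs => singleton_mem_cone_A.mp (h.singleton_mem_cone hs) p⟩⟩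

theorem re_stateSpace_mem {S : OSys.{u} 𝕜} {s t : S.carrier} (hs : !![s] ∈ S.cone 1)
    (ht : !![t] ∈ S.cone 1) (hst : s + t = S.unit) (φ : S.stateSpace) :
    RCLike.re (φ.1 t) ∈ Set.Icc 0 1 := by
  obtain ⟨_, φ, rfl, h1, h0⟩ := φ
  rw [← hst, map_add] at h1
  have h2 := congrArg RCLike.re h1
  rw [map_add, RCLike.one_re] at h2
  exact ⟨(RCLike.nonneg_iff.mp (h0 t ht)).1,
    by linarith [(RCLike.nonneg_iff.mp (h0 s hs)).1]⟩

/-- A system whose state space is a simplex has no morphism to `A(Δ³)` that equalizes the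
midpoints of two opposite edges and whose image contains the coordinate functions of the square. -/
theorem not_square {S : OSys.{u} 𝕜} (hS : IsChoquetSimplex S.stateSpace)
    (h : S ⟶ A 𝕜 (simplex.{u} 3)) (w : h ≫ pullback 𝕜 midF = h ≫ pullback 𝕜 midG)
    (k l : A 𝕜 (simplex.{u} 1) ⟶ S)
    (hk : k ≫ h = pullback 𝕜 (toSquare ≫ squareCoord 0))
    (hl : l ≫ h = pullback 𝕜 (toSquare ≫ squareCoord 1)) : False := by
  -- A morphism from `A(Δ¹)` marks an element of `S` between 0 and the unit, the image of `x 1`; its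
  -- complement is the image of `x 0`. Evaluation at this element is a [0, 1]-valued affine function
  -- on the states.
  let x (i : Fin 2) : (A 𝕜 (simplex.{u} 1)).carrier := (coordA 𝕜 i : (simplex 1).affineFunctions 𝕜)
  have hx : x 0 + x 1 = (A 𝕜 (simplex.{u} 1)).unit :=
    (Fin.sum_univ_two (coordA.{u} (n := 1) 𝕜)).symm.trans (sum_coordA 1)
  have mem : ∀ (k : A 𝕜 (simplex.{u} 1) ⟶ S) (φ : S.stateSpace),
      RCLike.re (φ.1 (k.toLinearMap (x 1))) ∈ Set.Icc 0 1 := fun k =>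
    re_stateSpace_mem (k.singleton_mem_cone (coordA_mem_cone 0))
      (k.singleton_mem_cone (coordA_mem_cone 1))
      ((k.toLinearMap.map_add _ _).symm.trans ((congrArg k.toLinearMap hx).trans k.map_unit))
  have aff : ∀ (s : S.carrier) (φ ψ χ : S.stateSpace) (a b : ℝ), 0 ≤ a → 0 ≤ b → a + b = 1 →
      χ.1 = a • φ.1 + b • ψ.1 →
        RCLike.re (χ.1 s) = a * RCLike.re (φ.1 s) + b * RCLike.re (ψ.1 s) := by
    intro s φ ψ χ a b _ _ _ e
    rw [e]
    simp [RCLike.smul_re]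
  have mid : ∀ s, (Hom.affineFunction h s).1
      (edgeMidpoint 0 1) = (Hom.affineFunction h s).1
      (edgeMidpoint 2 3) := fun s =>
    congrArg (fun f : S ⟶ A 𝕜 (simplex.{u} 0) =>
      (Hom.affineFunction f s).1 (vertex 0)) w
  have sum : ((evalState h (vertex 0)).1 + (evalState h (vertex 1)).1 : S.carrier → 𝕜) =
      (evalState h (vertex 2)).1 + (evalState h (vertex 3)).1 := by
    funext s
    have e := mid s
    rw [(Hom.affineFunction h s).2.map_midpoint (x := vertex 0) (y := vertex 1)
      (z := edgeMidpoint 0 1) rfl,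
      (Hom.affineFunction h s).2.map_midpoint (x := vertex 2) (y := vertex 3)
      (z := edgeMidpoint 2 3) rfl, midpoint_eq_smul_add, midpoint_eq_smul_add] at e
    exact smul_right_injective _ (by norm_num : (⅟2 : ℝ) ≠ 0) e
  have hk' : ∀ i, RCLike.re ((evalState h (vertex i)).1 (k.toLinearMap (x 1))) =
      coord.{u} 1 (vertex i) + coord.{u} 2 (vertex i) := fun i =>
    (congrArg (fun f : A 𝕜 (simplex.{u} 1) ⟶ A 𝕜 (simplex.{u} 3) => RCLike.re
      ((Hom.affineFunction f (x 1)).1 (vertex i))) hk).trans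
      (RCLike.ofReal_re _)
  have hl' : ∀ i, RCLike.re ((evalState h (vertex i)).1 (l.toLinearMap (x 1))) =
      coord.{u} 1 (vertex i) + coord.{u} 3 (vertex i) := fun i =>
    (congrArg (fun f : A 𝕜 (simplex.{u} 1) ⟶ A 𝕜 (simplex.{u} 3) => RCLike.re
      ((Hom.affineFunction f (x 1)).1 (vertex i))) hl).trans
      (RCLike.ofReal_re _)
  refine hS.not_square sum (aff (k.toLinearMap (x 1))) (aff (l.toLinearMap (x 1))) (mem k) (mem l)
    ?_ ?_ ?_ ?_
  · rw [hk', coord_vertex, coord_vertex]; simp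
  · rw [hk', coord_vertex, coord_vertex]; simp
  · rw [hl', coord_vertex, coord_vertex]; simp
  · rw [hl', coord_vertex, coord_vertex]; simp

theorem pullback_toSquare_comp (i : Fin 2) :
    pullback 𝕜 (toSquare.{u} ≫ squareCoord i) ≫ pullback 𝕜 midF =
      pullback 𝕜 (toSquare ≫ squareCoord i) ≫ pullback 𝕜 midG :=
  congrArg (fun f => pullback 𝕜 (f ≫ squareCoord i)) midF_toSquare

/-- The system of affine functions on the square has no reflection in a class of systems whose
state spaces are simplices. -/
theorem not_universal {S : OSys.{u} 𝕜} (hS : IsChoquetSimplex S.stateSpace)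
    (η : A 𝕜 square.{u} ⟶ S) (h : S ⟶ A 𝕜 (simplex.{u} 3)) (fac : η ≫ h = pullback 𝕜 toSquare)
    (uniq : ∀ f g : S ⟶ A 𝕜 (simplex.{u} 0), η ≫ f = η ≫ g → f = g) : False := by
  -- Uniqueness makes `h` equalize the two midpoints: after precomposition with `η` both composites
  -- come from the maps Δ⁰ ⟶ I² that `toSquare` identifies.
  refine not_square hS h (uniq _ _ ?_) (pullback 𝕜 (squareCoord 0) ≫ η)
    (pullback 𝕜 (squareCoord 1) ≫ η) ?_ ?_
  · rw [← Category.assoc, ← Category.assoc, fac]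
    exact congrArg (pullback 𝕜) midF_toSquare
  · rw [Category.assoc, fac]
    rfl
  · rw [Category.assoc, fac]
    rfl

/-! ### Missing equalizers, coproducts and reflections. -/

variable {P : ObjectProperty (OSys.{u} 𝕜)}

theorem not_hasEqualizer (hP : P ≤ IsSimplexSystem) (h₀ : P (A 𝕜 (simplex.{u} 0)))
    (h₁ : P (A 𝕜 (simplex.{u} 1))) (h₃ : P (A 𝕜 (simplex.{u} 3))) :
    ¬ HasEqualizer
      (ObjectProperty.homMk (pullback 𝕜 midF.{u}) : (⟨_, h₃⟩ : P.FullSubcategory) ⟶ ⟨_, h₀⟩)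
      (ObjectProperty.homMk (pullback 𝕜 midG.{u})) := by
  intro H
  let p (i : Fin 2) : (⟨_, h₁⟩ : P.FullSubcategory) ⟶ ⟨_, h₃⟩ :=
    ObjectProperty.homMk (pullback 𝕜 (toSquare ≫ squareCoord i))
  let f : (⟨_, h₃⟩ : P.FullSubcategory) ⟶ ⟨_, h₀⟩ := ObjectProperty.homMk (pullback 𝕜 midF.{u})
  let g : (⟨_, h₃⟩ : P.FullSubcategory) ⟶ ⟨_, h₀⟩ := ObjectProperty.homMk (pullback 𝕜 midG.{u})
  have : HasEqualizer f g := H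
  have w : ∀ i, p i ≫ f = p i ≫ g := fun i => ObjectProperty.hom_ext _ (pullback_toSquare_comp i)
  exact not_square (hP _ (equalizer f g).property).2 (equalizer.ι f g).hom
    (congrArg (fun f => f.hom) (equalizer.condition f g))
    (equalizer.lift (p 0) (w 0)).hom (equalizer.lift (p 1) (w 1)).hom
    (congrArg (fun f => f.hom) (equalizer.lift_ι (p 0) (w 0)))
    (congrArg (fun f => f.hom) (equalizer.lift_ι (p 1) (w 1)))

/-- A class of systems dual to simplices does not have the coproduct of `A(Δ¹)` with itself. -/
theorem not_hasBinaryCoproduct (hP : P ≤ IsSimplexSystem)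
    (h₀ : P (A 𝕜 (simplex.{u} 0))) (h₁ : P (A 𝕜 (simplex.{u} 1)))
    (h₃ : P (A 𝕜 (simplex.{u} 3))) :
    ¬ HasBinaryCoproduct (⟨_, h₁⟩ : P.FullSubcategory) ⟨_, h₁⟩ := by
  intro H
  let X : P.FullSubcategory := ⟨_, h₁⟩
  let p (i : Fin 2) : X ⟶ ⟨_, h₃⟩ :=
    ObjectProperty.homMk (pullback 𝕜 (toSquare ≫ squareCoord i))
  have : HasBinaryCoproduct X X := H
  let f : (⟨_, h₃⟩ : P.FullSubcategory) ⟶ ⟨_, h₀⟩ := ObjectProperty.homMk (pullback 𝕜 midF.{u})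
  let g : (⟨_, h₃⟩ : P.FullSubcategory) ⟶ ⟨_, h₀⟩ := ObjectProperty.homMk (pullback 𝕜 midG.{u})
  have w : ∀ i, p i ≫ f = p i ≫ g := fun i => ObjectProperty.hom_ext _ (pullback_toSquare_comp i)
  -- The coproduct injections are jointly epimorphic, so equality can be tested on the two summands,
  -- where it is `w`.
  have hw : coprod.desc (p 0) (p 1) ≫ f = coprod.desc (p 0) (p 1) ≫ g := by
    ext1
    · rw [coprod.inl_desc_assoc, coprod.inl_desc_assoc, w]
    · rw [coprod.inr_desc_assoc, coprod.inr_desc_assoc, w]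
  exact not_square (hP _ (X ⨿ X).property).2 (coprod.desc (p 0) (p 1)).hom
    (congrArg (fun f => f.hom) hw) (coprod.inl : X ⟶ X ⨿ X).hom (coprod.inr : X ⟶ X ⨿ X).hom
    (congrArg (fun f => f.hom) (coprod.inl_desc (p 0) (p 1)))
    (congrArg (fun f => f.hom) (coprod.inr_desc (p 0) (p 1)))

theorem not_isLocallyPresentable (hP : P ≤ IsSimplexSystem) (h₀ : P (A 𝕜 (simplex.{u} 0)))
    (h₁ : P (A 𝕜 (simplex.{u} 1))) (h₃ : P (A 𝕜 (simplex.{u} 3))) :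
    ¬ IsLocallyPresentable.{u} P.FullSubcategory := by
  rintro ⟨κ, _, _⟩
  have : HasColimits P.FullSubcategory :=
    IsCardinalLocallyPresentable.toHasColimitsOfSize (κ := κ)
  exact not_hasBinaryCoproduct hP h₀ h₁ h₃ inferInstance

/-- The reflection of `A(I²)` is tested against `A(Δ³)` for the existence of a factorization and
against `A(Δ⁰)` for its uniqueness. -/
theorem isEmpty_reflective_ι (hP : P ≤ IsSimplexSystem) (h₀ : P (A 𝕜 (simplex.{u} 0)))
    (h₃ : P (A 𝕜 (simplex.{u} 3))) : IsEmpty (Reflective P.ι) := by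
  refine ⟨fun R => ?_⟩
  let adj := R.adj
  let e := adj.homEquiv (A 𝕜 square.{u}) ⟨_, h₃⟩
  refine not_universal (hP _ (R.L.obj (A 𝕜 square.{u})).property).2 (adj.unit.app _)
    (e.symm (pullback 𝕜 toSquare)).hom ?_ fun f g hfg => ?_
  · exact (adj.homEquiv_unit ..).symm.trans (e.apply_symm_apply _)
  · have := (adj.homEquiv (A 𝕜 square.{u}) ⟨_, h₀⟩).injective
      (a₁ := ObjectProperty.homMk f) (a₂ := ObjectProperty.homMk g)
      (by rw [adj.homEquiv_unit, adj.homEquiv_unit]; exact hfg)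
    exact congrArg (fun f => f.hom) this

/-- The same argument inside `Q`, which only has to contain `A(I²)`; this covers complete function
systems and complete operator systems alike. -/
theorem isEmpty_reflective_ιOfLE {Q : ObjectProperty (OSys.{u} 𝕜)} (hPQ : P ≤ Q)
    (hP : P ≤ IsSimplexSystem) (h₀ : P (A 𝕜 (simplex.{u} 0))) (h₃ : P (A 𝕜 (simplex.{u} 3)))
    (hQ : Q (A 𝕜 square.{u})) : IsEmpty (Reflective (ObjectProperty.ιOfLE hPQ)) := by
  refine ⟨fun R => ?_⟩
  let adj := R.adj
  let X : Q.FullSubcategory := ⟨_, hQ⟩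
  let e := adj.homEquiv X ⟨_, h₃⟩
  refine not_universal (hP _ (R.L.obj X).property).2 (adj.unit.app X).hom
    (e.symm (ObjectProperty.homMk (pullback 𝕜 toSquare))).hom ?_ fun f g hfg => ?_
  · exact congrArg (fun f => f.hom) ((adj.homEquiv_unit ..).symm.trans (e.apply_symm_apply _))
  · have := (adj.homEquiv X ⟨_, h₀⟩).injective
      (a₁ := ObjectProperty.homMk f) (a₂ := ObjectProperty.homMk g)
      (by rw [adj.homEquiv_unit, adj.homEquiv_unit]; exact ObjectProperty.hom_ext _ hfg)
    exact congrArg (fun f => f.hom) this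

theorem isBauerSystem_le_isSimplexSystem :
    (IsBauerSystem : ObjectProperty (OSys.{u} 𝕜)) ≤ IsSimplexSystem :=
  fun _ h => ⟨h.1, h.2.1⟩

end OSys

theorem mainTheorem6 (𝕜 : Type) [RCLike 𝕜] :
    -- the coequalizer of the two points of the tetrahedron, among compact convex sets, is a square
    (∃ (q : CompConv.simplex.{u} 3 ⟶ CompConv.square.{u})
        (w : CompConv.midF.{u} ≫ q = CompConv.midG.{u} ≫ q),
      Nonempty (IsColimit (Cofork.ofπ q w))) ∧
    -- the square has no universal map to a Choquet simplex, and none to a Bauer simplex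
    (∀ U : StructuredArrow CompConv.square.{u} CompConv.IsChoquet.{u}.ι, IsEmpty (IsInitial U)) ∧
    (∀ U : StructuredArrow CompConv.square.{u} CompConv.IsBauer.{u}.ι, IsEmpty (IsInitial U)) ∧
    -- the pair has no coequalizer among the Choquet simplices, and none among the Bauer simplices
    (∃ (h₀ : CompConv.IsChoquet (CompConv.simplex.{u} 0))
        (h₃ : CompConv.IsChoquet (CompConv.simplex.{u} 3)),
      ¬ HasCoequalizer
        (ObjectProperty.homMk CompConv.midF.{u} :
          (⟨_, h₀⟩ : CompConv.IsChoquet.{u}.FullSubcategory) ⟶ ⟨_, h₃⟩)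
        (ObjectProperty.homMk CompConv.midG.{u})) ∧
    (∃ (h₀ : CompConv.IsBauer (CompConv.simplex.{u} 0))
        (h₃ : CompConv.IsBauer (CompConv.simplex.{u} 3)),
      ¬ HasCoequalizer
        (ObjectProperty.homMk CompConv.midF.{u} :
          (⟨_, h₀⟩ : CompConv.IsBauer.{u}.FullSubcategory) ⟶ ⟨_, h₃⟩)
        (ObjectProperty.homMk CompConv.midG.{u})) ∧
    -- the dual pair has no equalizer among the function systems dual to simplices
    (∃ (h₃ : OSys.IsSimplexSystem (CompConv.A 𝕜 (CompConv.simplex.{u} 3)))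
        (h₀ : OSys.IsSimplexSystem (CompConv.A 𝕜 (CompConv.simplex.{u} 0))),
      ¬ HasEqualizer
        (ObjectProperty.homMk (CompConv.pullback 𝕜 CompConv.midF.{u}) :
          (⟨_, h₃⟩ : (OSys.IsSimplexSystem.{u} (𝕜 := 𝕜)).FullSubcategory) ⟶ ⟨_, h₀⟩)
        (ObjectProperty.homMk (CompConv.pullback 𝕜 CompConv.midG.{u}))) ∧
    (∃ (h₃ : OSys.IsBauerSystem (CompConv.A 𝕜 (CompConv.simplex.{u} 3)))
        (h₀ : OSys.IsBauerSystem (CompConv.A 𝕜 (CompConv.simplex.{u} 0))),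
      ¬ HasEqualizer
        (ObjectProperty.homMk (CompConv.pullback 𝕜 CompConv.midF.{u}) :
          (⟨_, h₃⟩ : (OSys.IsBauerSystem.{u} (𝕜 := 𝕜)).FullSubcategory) ⟶ ⟨_, h₀⟩)
        (ObjectProperty.homMk (CompConv.pullback 𝕜 CompConv.midG.{u}))) ∧
    -- neither category has equalizers
    ¬ HasEqualizers (OSys.IsSimplexSystem.{u} (𝕜 := 𝕜)).FullSubcategory ∧
    ¬ HasEqualizers (OSys.IsBauerSystem.{u} (𝕜 := 𝕜)).FullSubcategory ∧
    -- neither category is locally presentable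
    ¬ IsLocallyPresentable.{u} (OSys.IsSimplexSystem.{u} (𝕜 := 𝕜)).FullSubcategory ∧
    ¬ IsLocallyPresentable.{u} (OSys.IsBauerSystem.{u} (𝕜 := 𝕜)).FullSubcategory ∧
    -- the inclusions into complete function systems, complete operator systems, operator systems
    IsEmpty (Reflective (ObjectProperty.ιOfLE (OSys.isSimplexSystem_le.{u} (𝕜 := 𝕜)))) ∧
    IsEmpty (Reflective (ObjectProperty.ιOfLE
      ((OSys.isSimplexSystem_le.{u} (𝕜 := 𝕜)).trans OSys.isFunctionSystem_le))) ∧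
    IsEmpty (Reflective (OSys.IsSimplexSystem.{u} (𝕜 := 𝕜)).ι) ∧
    IsEmpty (Reflective (ObjectProperty.ιOfLE (OSys.isBauerSystem_le.{u} (𝕜 := 𝕜)))) ∧
    IsEmpty (Reflective (ObjectProperty.ιOfLE
      ((OSys.isBauerSystem_le.{u} (𝕜 := 𝕜)).trans OSys.isFunctionSystem_le))) ∧
    IsEmpty (Reflective (OSys.IsBauerSystem.{u} (𝕜 := 𝕜)).ι) := by
  have hP := OSys.isBauerSystem_le_isSimplexSystem (𝕜 := 𝕜)
  have hs := CompConv.isSimplexSystem_A_simplex.{u} (𝕜 := 𝕜)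
  have hb := CompConv.isBauerSystem_A_simplex.{u} (𝕜 := 𝕜)
  have hQ := CompConv.isFunctionSystem_A (𝕜 := 𝕜) CompConv.square.{u}
  exact ⟨⟨CompConv.toSquare, CompConv.midF_toSquare, ⟨CompConv.isColimitToSquare⟩⟩,
    CompConv.isEmpty_isInitial le_rfl (CompConv.isBauer_simplex 1).1,
    CompConv.isEmpty_isInitial (fun _ h => h.1) (CompConv.isBauer_simplex 1),
    ⟨(CompConv.isBauer_simplex 0).1, (CompConv.isBauer_simplex 3).1,
      CompConv.not_hasCoequalizer le_rfl _ (CompConv.isBauer_simplex 1).1 _⟩,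
    ⟨CompConv.isBauer_simplex 0, CompConv.isBauer_simplex 3,
      CompConv.not_hasCoequalizer (fun _ h => h.1) _ (CompConv.isBauer_simplex 1) _⟩,
    ⟨hs 3, hs 0, OSys.not_hasEqualizer le_rfl _ (hs 1) _⟩,
    ⟨hb 3, hb 0, OSys.not_hasEqualizer hP _ (hb 1) _⟩,
    fun _ => OSys.not_hasEqualizer le_rfl (hs 0) (hs 1) (hs 3) inferInstance,
    fun _ => OSys.not_hasEqualizer hP (hb 0) (hb 1) (hb 3) inferInstance,
    OSys.not_isLocallyPresentable le_rfl (hs 0) (hs 1) (hs 3),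
    OSys.not_isLocallyPresentable hP (hb 0) (hb 1) (hb 3),
    OSys.isEmpty_reflective_ιOfLE _ le_rfl (hs 0) (hs 3) hQ,
    OSys.isEmpty_reflective_ιOfLE _ le_rfl (hs 0) (hs 3) hQ.1,
    OSys.isEmpty_reflective_ι le_rfl (hs 0) (hs 3),
    OSys.isEmpty_reflective_ιOfLE _ hP (hb 0) (hb 3) hQ,
    OSys.isEmpty_reflective_ιOfLE _ hP (hb 0) (hb 3) hQ.1,
    OSys.isEmpty_reflective_ι hP (hb 0) (hb 3)⟩
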